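/- Let $(Z_t)_{t\in\mathbb Z}$ be a sequence of i.i.d. real random variables with $\operatorname{Var}(Z_0)<\infty$, whose common distribution function $F$ is symmetric, i.e. $F(-x)=1-F(x)$ for all $x\in\mathbb R$, and is continuously differentiable in a neighborhood of $0$, with derivative $f(0)$ at $0$. For $t\in\mathbb Z$ let $\mathcal F_t=\sigma(Z_t,Z_{t-1},\dots)$, and let $(Y_t)_{t\in\mathbb Z}$ and $(V_t)_{t\in\mathbb Z}$ be two real processes adapted to $(\mathcal F_t)_{t\in\mathbb Z}$ and jointly (strictly) stationary, i.e. for every $h\in\mathbb Z$ the process $(Y_{t+h},V_{t+h})_{t\in\mathbb Z}$ has the same law as $(Y_t,V_t)_{t\in\mathbb Z}$. Assume that $\mathbb E[Y_0^2V_0^2]<\infty$ and that $\mathbb E[|V_0|\,Y_0^2]<\infty$. Then, as $n\to\infty$, $$\sum_{t=1}^n V_{t-1}\bigl(|Z_t-n^{-1/2}Y_{t-1}|-|Z_t|\bigr)\ \xrightarrow{\ \mathcal L\ }\ \mathcal N\bigl(f(0)\,\mathbb E[V_0Y_0^2],\ \mathbb E[V_0^2Y_0^2]\bigr),$$ where $\mathcal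 N(m,0)$ denotes the Dirac mass at $m$. -/

import Mathlib

open MeasureTheory ProbabilityTheory Filter Set

/-- A process `(X_t)` indexed by `ℤ` is (strictly) stationary: for every shift `h`, the process
`(X_{t+h})` has the same law as `(X_t)`, as a random element of `ℤ → E` with the product
σ-algebra. -/
def IsStationaryProcess {Ω E : Type*} [MeasurableSpace Ω] [MeasurableSpace E]
    (P : Measure Ω) (X : ℤ → Ω → E) : Prop :=
  ∀ h : ℤ, IdentDistrib (fun ω (t : ℤ) => X (t + h) ω) (fun ω (t : ℤ) => X t ω) P P

/-!
The increment of the absolute value splits as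
`|z - y| - |z| = y * leSign z + R`, where `leSign z = ±1` and the remainder satisfies
`0 ≤ R ≤ 2 * |y|`. Apply this to `z = Z t` and `y = Y (t - 1) / √n`, which is known one step
earlier and is independent of `Z t`. Three parts result.

* **Linear part.** `n ^ (-1/2) * ∑ V (t - 1) * Y (t - 1) * leSign (Z t)`. Since the median of `Z t`
  is `0`, the variables `leSign (Z t)` are fair signs independent of the past, and the product
  `V (t - 1) * Y (t - 1)` is known. As `𝔼[exp (i a ξ)] = cos a ≈ exp (-a² / 2)` for a fair sign `ξ`,
  the process `exp (i ∑ a ξ + ∑ a² / 2)` is nearly a martingale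
  (`norm_integral_cexp_mul_exp_sub_one_le`). The sum of squares `∑ a²` converges to a constant by
  the law of large numbers, which gives a Gaussian limit (`tendsto_integral_cexp_sum_mul_sign`). To
  keep the exponentials bounded, the coefficients are set to `0` once their sum of squares is too
  large (`stopSq`).
* **Compensator of the remainder.** `𝔼[R] = absShift μ y` is the convex function
  `𝔼[|Z - y| - |Z|]`, with derivative `2 * F y - 1` near `0`, so it is `f 0 * y ^ 2 + o(y ^ 2)`
  (`absShift_sub_isLittleO`). Hence the compensator is the average of `f 0 * V k * Y k ^ 2` up to
  `o(1)`, and the law of large numbers gives the mean of the limit.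
* **Martingale part of the remainder.** Its summands are orthogonal, and `R ≤ 2 * |y|` bounds their
  second moments by `2 * |y| * absShift μ y = o(y ^ 2)`. Hence it vanishes in `L²`
  (`integral_sq_sum_mul_le`).

The law of large numbers (`tendsto_integral_abs_average_sub`) uses the stationarity of `(Y, V)`
alone, as the triple `(Z, Y, V)` need not be stationary. Ergodicity is replaced by a decay of
correlations: a variable adapted to the past of the i.i.d. sequence is nearly a function of finitely
many `Z t` (Lévy's upward theorem), hence nearly independent of the remote past.
-/

/-! ### A weak law of large numbers for stationary processes adapted to an i.i.d. sequence -/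

section WeakLaw

variable {Ω : Type*} [MeasurableSpace Ω] {P : Measure Ω}

lemma indepFun_of_indep {E E' : Type*} [MeasurableSpace E] [MeasurableSpace E']
    {m₁ m₂ : MeasurableSpace Ω} {X : Ω → E} {Y : Ω → E'}
    (h : Indep m₁ m₂ P) (hX : Measurable[m₁] X) (hY : Measurable[m₂] Y) : IndepFun X Y P :=
  indep_of_indep_of_le_left (indep_of_indep_of_le_right h hY.comap_le) hX.comap_le

lemma IsStationaryProcess.comp {E E' : Type*} [MeasurableSpace E] [MeasurableSpace E']
    {X : ℤ → Ω → E} (h : IsStationaryProcess P X) {g : E → E'} (hg : Measurable g) :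
    IsStationaryProcess P fun t ω => g (X t ω) := fun s =>
  (h s).comp (u := fun (w : ℤ → E) t => g (w t))
    (measurable_pi_lambda _ fun t => hg.comp (measurable_pi_apply t))

lemma IsStationaryProcess.identDistrib {E : Type*} [MeasurableSpace E]
    {X : ℤ → Ω → E} (h : IsStationaryProcess P X) (s : ℤ) : IdentDistrib (X s) (X 0) P P := by
  simpa [Function.comp_def] using (h s).comp (u := fun w : ℤ → E => w 0) (measurable_pi_apply 0)

/-- Truncation of real numbers at the levels `M = 0, 1, 2, …`. -/
lemma exists_truncation : ∃ T : ℕ → ℝ → ℝ, (∀ M, Measurable (T M)) ∧ (∀ M x, |T M x| ≤ M) ∧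
    (∀ M x, |x - T M x| ≤ |x|) ∧ ∀ (M : ℕ) (x : ℝ), |x| ≤ M → T M x = x := by
  refine ⟨fun M x => max (-M) (min M x), fun M => by fun_prop, fun M x => ?_, fun M x => ?_,
    fun M x hx => ?_⟩
  · have : (0 : ℝ) ≤ M := M.cast_nonneg
    rw [abs_le]
    exact ⟨le_max_left _ _, max_le (by linarith) (min_le_left _ _)⟩
  · have : (0 : ℝ) ≤ M := M.cast_nonneg
    rcases le_total (M : ℝ) x with h | h <;> rcases le_total (-(M : ℝ)) x with h' | h' <;>
      simp only [min_eq_left h, min_eq_right h, max_eq_right h', max_eq_left h',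
        max_eq_right (by linarith : -(M : ℝ) ≤ M)] <;> rw [abs_le] <;>
      constructor <;> cases abs_cases x <;> linarith
  · rw [abs_le] at hx
    simp [min_eq_right hx.2, max_eq_right hx.1]

variable [IsProbabilityMeasure P] {Z : ℤ → Ω → ℝ}

lemma integral_abs_le_sqrt_integral_sq {X : Ω → ℝ} (hX : MemLp X 2 P) :
    ∫ ω, |X ω| ∂P ≤ √(∫ ω, X ω ^ 2 ∂P) := by
  refine Real.le_sqrt_of_sq_le ?_
  have hv := variance_nonneg |X| P
  rw [variance_eq_sub hX.abs] at hv
  simp only [Pi.pow_apply, Pi.abs_apply, sq_abs] at hv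
  linarith

/-- Decay of correlations. Up to a small `L¹` error `X 0` is a function of finitely many of the
variables `Z 0, Z (-1), …`, which are independent of the past on which `X (-k)` depends for
large `k`. -/
lemma tendsto_integral_mul_of_adapted (hZ : ∀ t, Measurable (Z t)) (hindep : iIndepFun Z P)
    {X : ℤ → Ω → ℝ}
    (hX : Adapted (Filtration.natural Z fun t => (hZ t).stronglyMeasurable) X)
    {M : ℝ} (hM : ∀ t ω, |X t ω| ≤ M) (h0 : ∀ t, ∫ ω, X t ω ∂P = 0) :
    Tendsto (fun k : ℕ => ∫ ω, X (-k) ω * X 0 ω ∂P) atTop (nhds 0) := by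
  have hle : ∀ j, MeasurableSpace.comap (Z j) inferInstance ≤ ‹MeasurableSpace Ω› :=
    fun j => (hZ j).comap_le
  have hXm : ∀ t, Measurable (X t) := fun t => (hX t).mono (Filtration.le _ _) le_rfl
  have hM0 : 0 ≤ M := by
    obtain ⟨ω⟩ := nonempty_of_isProbabilityMeasure P
    exact (abs_nonneg _).trans (hM 0 ω)
  have hXi : ∀ t, Integrable (X t) P := fun t =>
    Integrable.of_bound (hXm t).aestronglyMeasurable M (ae_of_all _ (hM t))
  -- the filtration generated by the blocks `Z 0, …, Z (-m + 1)`
  let 𝒢 : Filtration ℕ ‹MeasurableSpace Ω› :=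
    { seq := fun m => ⨆ j ∈ Ioc (-(m : ℤ)) 0, MeasurableSpace.comap (Z j) inferInstance
      mono' := fun m n hmn => biSup_mono fun j hj => by
        simp only [mem_Ioc] at hj ⊢
        have : (m : ℤ) ≤ n := by exact_mod_cast hmn
        exact ⟨by linarith [hj.1], hj.2⟩
      le' := fun m => iSup₂_le fun j _ => hle j }
  have hsup : (Filtration.natural Z fun t => (hZ t).stronglyMeasurable) 0 ≤ ⨆ m, 𝒢 m := by
    refine iSup₂_le fun j hj => ?_
    refine le_iSup_of_le (j.natAbs + 1) ?_
    refine le_iSup₂_of_le (f := fun j _ => MeasurableSpace.comap (Z j) inferInstance) j ?_ le_rfl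
    simp only [mem_Ioc]
    omega
  have hlevy := (hXi 0).tendsto_eLpNorm_condExp (ℱ := 𝒢)
    ((hX 0).mono hsup le_rfl).stronglyMeasurable
  have hlevy' : Tendsto (fun m => ∫ ω, |(P[X 0 | 𝒢 m]) ω - X 0 ω| ∂P) atTop (nhds 0) := by
    have := (ENNReal.tendsto_toReal ENNReal.zero_ne_top).comp hlevy
    simp only [ENNReal.toReal_zero] at this
    refine this.congr fun m => ?_
    have hi : Integrable (P[X 0 | 𝒢 m] - X 0) P := integrable_condExp.sub (hXi 0)
    simp only [Function.comp]
    rw [eLpNorm_one_eq_lintegral_enorm, ← integral_norm_eq_lintegral_enorm hi.1]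
    simp [Real.norm_eq_abs]
  have key : ∀ m k : ℕ, m ≤ k →
      |∫ ω, X (-k) ω * X 0 ω ∂P| ≤ M * ∫ ω, |(P[X 0 | 𝒢 m]) ω - X 0 ω| ∂P := by
    intro m k hmk
    have hind : Indep ((Filtration.natural Z fun t => (hZ t).stronglyMeasurable) (-k)) (𝒢 m) P := by
      refine indep_iSup_of_disjoint (S := Iic (-(k : ℤ))) (T := Ioc (-(m : ℤ)) 0) hle
        hindep.iIndep ?_
      rw [Set.disjoint_left]
      intro j hj hj'
      simp only [mem_Iic, mem_Ioc] at hj hj'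
      omega
    have hI : IndepFun (X (-k)) (P[X 0 | 𝒢 m]) P :=
      indepFun_of_indep hind (hX _) stronglyMeasurable_condExp.measurable
    have hz : ∫ ω, X (-k) ω * (P[X 0 | 𝒢 m]) ω ∂P = 0 := by
      rw [hI.integral_fun_mul_eq_mul_integral (hXi _).1 integrable_condExp.1, h0, zero_mul]
    have hi1 : Integrable (fun ω => X (-k) ω * (P[X 0 | 𝒢 m]) ω) P :=
      integrable_condExp.bdd_mul (c := M) (hXm _).aestronglyMeasurable (ae_of_all _ (hM _))
    have hi2 : Integrable (fun ω => X (-k) ω * X 0 ω) P :=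
      (hXi 0).bdd_mul (c := M) (hXm _).aestronglyMeasurable (ae_of_all _ (hM _))
    have hsub : ∫ ω, X (-k) ω * X 0 ω ∂P
        = -∫ ω, X (-k) ω * ((P[X 0 | 𝒢 m]) ω - X 0 ω) ∂P := by
      simp_rw [mul_sub]
      rw [integral_sub hi1 hi2, hz]
      ring
    rw [hsub, abs_neg, ← integral_const_mul]
    refine (abs_integral_le_integral_abs).trans ?_
    refine integral_mono_of_nonneg (ae_of_all _ fun ω => abs_nonneg _)
      ((integrable_condExp.sub (hXi 0)).abs.const_mul M) (ae_of_all _ fun ω => ?_)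
    simp only [abs_mul]
    exact mul_le_mul_of_nonneg_right (hM _ _) (abs_nonneg _)
  rw [Metric.tendsto_atTop]
  intro δ hδ
  have h1 : Tendsto (fun m => M * ∫ ω, |(P[X 0 | 𝒢 m]) ω - X 0 ω| ∂P) atTop (nhds 0) := by
    simpa using hlevy'.const_mul M
  obtain ⟨m, hm⟩ := (h1.eventually (gt_mem_nhds hδ)).exists
  refine ⟨m, fun k hk => ?_⟩
  rw [Real.dist_eq, sub_zero]
  exact (key m k hk).trans_lt hm

/-- The sum of `r |i - j|` over the square `[0, n)²` is `o(n²)` when `r → 0`. -/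
lemma tendsto_sum_sum_natAbs_sub_div_sq {r : ℕ → ℝ} (hr : Tendsto r atTop (nhds 0)) :
    Tendsto (fun n : ℕ => (∑ i ∈ Finset.range n, ∑ j ∈ Finset.range n,
      r ((i : ℤ) - j).natAbs) / (n : ℝ) ^ 2) atTop (nhds 0) := by
  have habs : Tendsto (fun k => |r k|) atTop (nhds 0) := by simpa using hr.abs
  have hces := habs.cesaro.const_mul 2
  rw [mul_zero] at hces
  refine squeeze_zero_norm (fun n => ?_) hces
  have hrow : ∀ i ∈ Finset.range n, ∑ j ∈ Finset.range n, |r ((i : ℤ) - j).natAbs|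
      ≤ 2 * ∑ k ∈ Finset.range n, |r k| := by
    intro i hi
    have hi' := Finset.mem_range.1 hi
    rw [← Finset.sum_filter_add_sum_filter_not (Finset.range n) (fun j => j ≤ i), two_mul]
    refine add_le_add ?_ ?_
    · rw [← Finset.sum_image (s := (Finset.range n).filter (fun j => j ≤ i))
        (g := fun j : ℕ => ((i : ℤ) - j).natAbs) (f := fun k => |r k|)]
      · refine Finset.sum_le_sum_of_subset_of_nonneg ?_ fun _ _ _ => abs_nonneg _
        intro k hk
        simp only [Finset.mem_image, Finset.mem_filter, Finset.mem_range] at hk ⊢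
        omega
      · intro a ha b hb hab
        simp only [Finset.coe_filter, mem_ofPred_eq, Finset.mem_range] at ha hb hab
        omega
    · rw [← Finset.sum_image (s := (Finset.range n).filter (fun j => ¬ j ≤ i))
        (g := fun j : ℕ => ((i : ℤ) - j).natAbs) (f := fun k => |r k|)]
      · refine Finset.sum_le_sum_of_subset_of_nonneg ?_ fun _ _ _ => abs_nonneg _
        intro k hk
        simp only [Finset.mem_image, Finset.mem_filter, Finset.mem_range] at hk ⊢
        omega
      · intro a ha b hb hab
        simp only [Finset.coe_filter, mem_ofPred_eq, Finset.mem_range] at ha hb hab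
        omega
  rcases Nat.eq_zero_or_pos n with rfl | hn
  · simp
  have hn' : (0 : ℝ) < n := by exact_mod_cast hn
  rw [norm_div, Real.norm_eq_abs, Real.norm_of_nonneg (by positivity : (0 : ℝ) ≤ (n : ℝ) ^ 2),
    div_le_iff₀ (by positivity)]
  calc |∑ i ∈ Finset.range n, ∑ j ∈ Finset.range n, r ((i : ℤ) - j).natAbs|
      ≤ ∑ i ∈ Finset.range n, ∑ j ∈ Finset.range n, |r ((i : ℤ) - j).natAbs| :=
        (Finset.abs_sum_le_sum_abs _ _).trans
          (Finset.sum_le_sum fun i _ => Finset.abs_sum_le_sum_abs _ _)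
    _ ≤ ∑ _i ∈ Finset.range n, 2 * ∑ k ∈ Finset.range n, |r k| := Finset.sum_le_sum hrow
    _ = _ := by
      rw [Finset.sum_const, Finset.card_range, nsmul_eq_mul]
      field_simp

/-- `L²` law of large numbers for bounded centred processes, from the decay of correlations. -/
lemma tendsto_integral_sq_average_of_bounded (hZ : ∀ t, Measurable (Z t)) (hindep : iIndepFun Z P)
    {X : ℤ → Ω → ℝ}
    (hX : Adapted (Filtration.natural Z fun t => (hZ t).stronglyMeasurable) X)
    (hstat : IsStationaryProcess P X)
    {M : ℝ} (hM : ∀ t ω, |X t ω| ≤ M) (h0 : ∫ ω, X 0 ω ∂P = 0) :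
    Tendsto (fun n : ℕ => ∫ ω, ((∑ k ∈ Finset.range n, X k ω) / n) ^ 2 ∂P) atTop (nhds 0) := by
  have hXm : ∀ t, Measurable (X t) := fun t => (hX t).mono (Filtration.le _ _) le_rfl
  have hXi : ∀ t, Integrable (X t) P := fun t =>
    Integrable.of_bound (hXm t).aestronglyMeasurable M (ae_of_all _ (hM t))
  have hr := tendsto_integral_mul_of_adapted hZ hindep hX hM fun t => by
    rw [(hstat.identDistrib t).integral_eq, h0]
  refine (tendsto_sum_sum_natAbs_sub_div_sq hr).congr fun n => ?_
  have hcov : ∀ i j : ℤ, i ≤ j →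
      ∫ ω, X i ω * X j ω ∂P = ∫ ω, X (-((i - j).natAbs : ℤ)) ω * X 0 ω ∂P := by
    intro i j hij
    have := ((hstat j).comp (u := fun w : ℤ → ℝ => w (i - j) * w 0)
      (by fun_prop)).integral_eq
    simp only [Function.comp_def, sub_add_cancel, zero_add] at this
    rw [this]
    have : -((i - j).natAbs : ℤ) = i - j := by omega
    rw [this]
  have hcov' : ∀ i j : ℤ,
      ∫ ω, X i ω * X j ω ∂P = ∫ ω, X (-((i - j).natAbs : ℤ)) ω * X 0 ω ∂P := by
    intro i j
    rcases le_total i j with h | h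
    · exact hcov i j h
    · simp_rw [mul_comm (X i _)]
      rw [hcov j i h, ← Int.natAbs_neg, neg_sub]
  simp_rw [div_pow, integral_div, sq (∑ k ∈ Finset.range n, X k _), Finset.sum_mul_sum]
  have hi : ∀ i j : ℤ, Integrable (fun ω => X i ω * X j ω) P := fun i j =>
    (hXi j).bdd_mul (c := M) (hXm _).aestronglyMeasurable (ae_of_all _ (hM _))
  rw [integral_finsetSum _ fun i _ => integrable_finsetSum _ fun j _ => hi _ _]
  congr 1
  refine Finset.sum_congr rfl fun i _ => ?_
  rw [integral_finsetSum _ fun j _ => hi _ _]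
  exact Finset.sum_congr rfl fun j _ => (hcov' _ _).symm

/-- Cost, for the average of `X`, of passing to an `L¹` approximation `W` with centring `c`. -/
lemma integral_abs_average_sub_le {X W : ℕ → Ω → ℝ} {c m e : ℝ} (hX : ∀ k, Integrable (X k) P)
    (hW : ∀ k, Integrable (W k) P) (he : ∀ k, ∫ ω, |X k ω - W k ω| ∂P = e) (hcm : |c - m| ≤ e)
    {n : ℕ} (hn : 0 < n) :
    ∫ ω, |(∑ k ∈ Finset.range n, X k ω) / n - m| ∂P
      ≤ ∫ ω, |(∑ k ∈ Finset.range n, (W k ω - c)) / n| ∂P + 2 * e := by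
  have hn' : (0 : ℝ) < n := by exact_mod_cast hn
  have hi1 : Integrable (fun ω => |(∑ k ∈ Finset.range n, (W k ω - c)) / (n : ℝ)|) P :=
    ((integrable_finsetSum _ fun k _ => (hW k).sub (integrable_const c)).div_const _).abs
  have hi2' : ∀ k, Integrable (fun ω => |X k ω - W k ω|) P := fun k => ((hX k).sub (hW k)).abs
  have hi2 : Integrable (fun ω => (∑ k ∈ Finset.range n, |X k ω - W k ω|) / (n : ℝ)) P :=
    (integrable_finsetSum _ fun k _ => hi2' k).div_const _
  have hi12 : Integrable (fun ω => |(∑ k ∈ Finset.range n, (W k ω - c)) / (n : ℝ)|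
      + (∑ k ∈ Finset.range n, |X k ω - W k ω|) / (n : ℝ)) P := hi1.add hi2
  have hpt : ∀ ω, |(∑ k ∈ Finset.range n, X k ω) / n - m| ≤
      |(∑ k ∈ Finset.range n, (W k ω - c)) / (n : ℝ)|
      + (∑ k ∈ Finset.range n, |X k ω - W k ω|) / (n : ℝ) + e := by
    intro ω
    have hdec : (∑ k ∈ Finset.range n, X k ω) / n - m
        = (∑ k ∈ Finset.range n, (W k ω - c)) / (n : ℝ)
          + (∑ k ∈ Finset.range n, (X k ω - W k ω)) / (n : ℝ) + (c - m) := by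
      simp only [Finset.sum_sub_distrib, Finset.sum_const, Finset.card_range, nsmul_eq_mul]
      field_simp
      ring
    rw [hdec]
    refine (abs_add_le _ _).trans (add_le_add ((abs_add_le _ _).trans (add_le_add le_rfl ?_)) hcm)
    rw [abs_div, Nat.abs_cast]
    gcongr
    exact Finset.abs_sum_le_sum_abs _ _
  calc ∫ ω, |(∑ k ∈ Finset.range n, X k ω) / n - m| ∂P
      ≤ ∫ ω, (|(∑ k ∈ Finset.range n, (W k ω - c)) / (n : ℝ)|
      + (∑ k ∈ Finset.range n, |X k ω - W k ω|) / (n : ℝ) + e) ∂P :=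
        integral_mono_of_nonneg (ae_of_all _ fun ω => abs_nonneg _)
          (hi12.add (integrable_const _)) (ae_of_all _ hpt)
    _ = _ := by
      rw [integral_add hi12 (integrable_const _), integral_add hi1 hi2, integral_div,
        integral_finsetSum _ fun k _ => hi2' k]
      simp only [he, Finset.sum_const, Finset.card_range, nsmul_eq_mul, integral_const,
        probReal_univ, smul_eq_mul]
      field_simp
      ring

/-- `L¹` law of large numbers. Stationarity is only required of `X`, not of the pair `(X, Z)`. -/
lemma tendsto_integral_abs_average_sub (hZ : ∀ t, Measurable (Z t)) (hindep : iIndepFun Z P)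
    {X : ℤ → Ω → ℝ}
    (hX : Adapted (Filtration.natural Z fun t => (hZ t).stronglyMeasurable) X)
    (hstat : IsStationaryProcess P X) (hint : Integrable (X 0) P) :
    Tendsto (fun n : ℕ => ∫ ω, |(∑ k ∈ Finset.range n, X k ω) / n - ∫ ω, X 0 ω ∂P| ∂P)
      atTop (nhds 0) := by
  have hXm : ∀ t, Measurable (X t) := fun t => (hX t).mono (Filtration.le _ _) le_rfl
  have hXi : ∀ t, Integrable (X t) P := fun t => (hstat.identDistrib t).integrable_iff.2 hint
  -- truncation at level `M`
  obtain ⟨T, hTm, hTb, hTle, hTeq⟩ := exists_truncation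
  have hTi : ∀ M t, Integrable (fun ω => T M (X t ω)) P := fun M t =>
    Integrable.of_bound ((hTm M).comp (hXm t)).aestronglyMeasurable M (ae_of_all _ fun ω => hTb _ _)
  have htrunc : Tendsto (fun M : ℕ => ∫ ω, |X 0 ω - T M (X 0 ω)| ∂P) atTop (nhds 0) := by
    rw [← integral_zero Ω ℝ (μ := P)]
    refine tendsto_integral_of_dominated_convergence (fun ω => |X 0 ω|)
      (fun M => ((hXm 0).sub ((hTm M).comp (hXm 0))).abs.aestronglyMeasurable) hint.abs
      (fun M => ae_of_all _ fun ω => by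
        rw [Real.norm_eq_abs, abs_abs]; exact hTle M _) (ae_of_all _ fun ω => ?_)
    obtain ⟨M₀, hM₀⟩ := exists_nat_ge |X 0 ω|
    refine tendsto_const_nhds.congr' ?_
    filter_upwards [eventually_ge_atTop M₀] with M hM
    rw [hTeq M _ (hM₀.trans (by exact_mod_cast hM)), sub_self, abs_zero]
  have hbdd : ∀ M : ℕ, Tendsto (fun n : ℕ => ∫ ω, |(∑ k ∈ Finset.range n,
      (T M (X k ω) - ∫ ω, T M (X 0 ω) ∂P)) / n| ∂P) atTop (nhds 0) := by
    intro M
    set c := ∫ ω, T M (X 0 ω) ∂P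
    have hc : |c| ≤ M := by
      have := norm_integral_le_of_norm_le_const (μ := P) (f := fun ω => T M (X 0 ω)) (C := M)
        (ae_of_all _ fun ω => hTb _ _)
      simpa using this
    have hg : Measurable (fun x => T M x - c) := (hTm M).sub_const c
    have hb : ∀ (t : ℤ) ω, |T M (X t ω) - c| ≤ 2 * M := fun t ω =>
      (abs_sub _ _).trans (by linarith [hTb M (X t ω)])
    have h2 := tendsto_integral_sq_average_of_bounded hZ hindep
      (X := fun t ω => T M (X t ω) - c) (fun t => hg.comp (hX t)) (hstat.comp hg) hb (by
        rw [integral_sub (hTi M 0) (integrable_const _)]; simp [c])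
    have h3 := h2.sqrt
    rw [Real.sqrt_zero] at h3
    refine squeeze_zero (fun n => integral_nonneg fun ω => abs_nonneg _) (fun n => ?_) h3
    have hmeas : Measurable fun ω => (∑ k ∈ Finset.range n, (T M (X k ω) - c)) / n :=
      (Finset.measurable_fun_sum _ fun (k : ℕ) _ => hg.comp (hXm k)).div_const _
    have hbd : ∀ ω, |(∑ k ∈ Finset.range n, (T M (X k ω) - c)) / n| ≤ 2 * M := by
      intro ω
      rcases Nat.eq_zero_or_pos n with rfl | hn
      · simp
      rw [abs_div, Nat.abs_cast, div_le_iff₀ (by exact_mod_cast hn)]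
      refine (Finset.abs_sum_le_sum_abs _ _).trans ?_
      refine (Finset.sum_le_sum fun (k : ℕ) _ => hb k ω).trans ?_
      simp [mul_comm]
    exact integral_abs_le_sqrt_integral_sq (MemLp.of_bound hmeas.aestronglyMeasurable (2 * M)
      (ae_of_all _ hbd))
  have key : ∀ M n : ℕ, 0 < n →
      ∫ ω, |(∑ k ∈ Finset.range n, X k ω) / n - ∫ ω, X 0 ω ∂P| ∂P
      ≤ ∫ ω, |(∑ k ∈ Finset.range n, (T M (X k ω) - ∫ ω, T M (X 0 ω) ∂P)) / n| ∂P
        + 2 * ∫ ω, |X 0 ω - T M (X 0 ω)| ∂P := by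
    intro M n hn
    refine integral_abs_average_sub_le (X := fun k => X k) (W := fun k ω => T M (X k ω))
      (fun k => hXi k) (fun k => hTi M k) (fun k => ?_) ?_ hn
    · exact ((hstat.identDistrib k).comp (u := fun x => |x - T M x|)
        (measurable_id.sub (hTm M)).abs).integral_eq
    · rw [abs_sub_comm, ← integral_sub hint (hTi M 0)]
      exact abs_integral_le_integral_abs
  rw [Metric.tendsto_atTop]
  intro δ hδ
  obtain ⟨M, hM⟩ := (htrunc.eventually (gt_mem_nhds (by positivity : 0 < δ / 4))).exists
  obtain ⟨N, hN⟩ := eventually_atTop.1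
    ((hbdd M).eventually (gt_mem_nhds (by positivity : 0 < δ / 2)))
  refine ⟨max N 1, fun n hn => ?_⟩
  rw [Real.dist_eq, sub_zero, abs_of_nonneg (integral_nonneg fun ω => abs_nonneg _)]
  have := key M n (by have := le_max_right N 1; omega)
  have := hN n ((le_max_left _ _).trans hn)
  linarith

end WeakLaw

/-! ### A central limit theorem for predictable multiples of symmetric signs -/

section SignCLT

/-- `cos a` agrees with `exp (-a ^ 2 / 2)` to fourth order, in relative error. -/
lemma abs_cos_mul_exp_sub_one_le (a : ℝ) :
    |Real.cos a * Real.exp (a ^ 2 / 2) - 1| ≤ 2 * Real.exp (a ^ 2 / 2) * a ^ 4 := by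
  have he : 1 ≤ Real.exp (a ^ 2 / 2) := Real.one_le_exp (by positivity)
  rcases le_total |a| 1 with ha | ha
  · have hsq : a ^ 2 ≤ 1 := (sq_le_one_iff_abs_le_one a).2 ha
    have h1 := Real.cos_bound ha
    have h2 := Real.abs_exp_sub_one_sub_id_le (x := -(a ^ 2 / 2)) (by
      rw [abs_neg, abs_of_nonneg (by positivity)]; linarith)
    have h4 : |a| ^ 4 = a ^ 4 := by rw [← abs_pow, abs_of_nonneg (by positivity)]
    rw [h4] at h1
    have h3 : Real.cos a * Real.exp (a ^ 2 / 2) - 1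
        = Real.exp (a ^ 2 / 2) * ((Real.cos a - (1 - a ^ 2 / 2))
          - (Real.exp (-(a ^ 2 / 2)) - 1 - -(a ^ 2 / 2))) := by
      have : Real.exp (a ^ 2 / 2) * Real.exp (-(a ^ 2 / 2)) = 1 := by
        rw [← Real.exp_add]; simp
      linear_combination this
    have h5 : 0 ≤ a ^ 4 := by positivity
    rw [h3, abs_mul, abs_of_pos (Real.exp_pos _), mul_assoc, mul_left_comm]
    refine mul_le_mul_of_nonneg_left ?_ (Real.exp_pos _).le
    refine (abs_sub _ _).trans ?_
    nlinarith
  · have hsq : 1 ≤ a ^ 2 := (one_le_sq_iff_one_le_abs a).2 ha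
    have h4 : 1 ≤ a ^ 4 := by nlinarith
    have hc : |Real.cos a * Real.exp (a ^ 2 / 2)| ≤ Real.exp (a ^ 2 / 2) := by
      rw [abs_mul, abs_of_pos (Real.exp_pos _)]
      exact mul_le_of_le_one_left (Real.exp_pos _).le (Real.abs_cos_le_one a)
    refine (abs_sub _ _).trans ?_
    rw [abs_one]
    nlinarith [Real.exp_pos (a ^ 2 / 2)]

lemma abs_one_sub_exp_le {x C : ℝ} (hC : 0 ≤ C) (hx : x ≤ C) :
    |1 - Real.exp x| ≤ Real.exp C * |x| := by
  have hC1 : 1 ≤ Real.exp C := Real.one_le_exp hC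
  rcases le_total x 0 with h | h
  · rw [abs_of_nonneg (by simpa using h), abs_of_nonpos h]
    nlinarith [Real.add_one_le_exp x]
  · rw [abs_of_nonpos (by simpa using h), abs_of_nonneg h]
    have h1 := Real.add_one_le_exp (-x)
    have h2 : Real.exp x * Real.exp (-x) = 1 := by rw [← Real.exp_add]; simp
    have h3 : Real.exp x ≤ Real.exp C := Real.exp_le_exp.2 hx
    nlinarith [Real.exp_pos x]

/-- The sequence `A`, replaced by `0` from the first time on at which the running sum of squares
exceeds `c`. The condition at `k` involves `A 0, …, A k` only, so that predictability is kept. -/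
noncomputable def stopSq (c : ℝ) (A : ℕ → ℝ) (k : ℕ) : ℝ :=
  if ∑ j ∈ Finset.range (k + 1), A j ^ 2 ≤ c then A k else 0

lemma stopSq_sq_le (c : ℝ) (A : ℕ → ℝ) (k : ℕ) : stopSq c A k ^ 2 ≤ A k ^ 2 := by
  unfold stopSq
  split_ifs
  · exact le_rfl
  · simpa using sq_nonneg (A k)

lemma sum_stopSq_sq_le {c : ℝ} (hc : 0 ≤ c) (A : ℕ → ℝ) (n : ℕ) :
    ∑ k ∈ Finset.range n, stopSq c A k ^ 2 ≤ c := by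
  induction n with
  | zero => simpa using hc
  | succ n ih =>
    by_cases h : ∑ j ∈ Finset.range (n + 1), A j ^ 2 ≤ c
    · exact (Finset.sum_le_sum fun k _ => stopSq_sq_le c A k).trans h
    · rw [Finset.sum_range_succ]
      simpa [stopSq, h] using ih

lemma stopSq_eq {c : ℝ} {A : ℕ → ℝ} {n : ℕ} (h : ∑ j ∈ Finset.range n, A j ^ 2 ≤ c) {k : ℕ}
    (hk : k < n) : stopSq c A k = A k := by
  refine if_pos (le_trans ?_ h)
  exact Finset.sum_le_sum_of_subset_of_nonneg (Finset.range_mono hk) fun _ _ _ => sq_nonneg _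

variable {Ω : Type*} [MeasurableSpace Ω] {P : Measure Ω} [IsProbabilityMeasure P]
  {ℱ : Filtration ℕ ‹MeasurableSpace Ω›} {ξ : ℕ → Ω → ℝ}

/-- `exp (i ∑ a_k ξ_k + ∑ a_k² / 2)` is nearly a martingale, since
`𝔼[exp (i a ξ)] = cos a ≈ exp (-a² / 2)` for a symmetric sign `ξ`. -/
lemma norm_integral_cexp_mul_exp_sub_one_le
    (hξm : ∀ k, Measurable[ℱ (k + 1)] (ξ k))
    (hξi : ∀ k, Indep (ℱ k) (MeasurableSpace.comap (ξ k) inferInstance) P)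
    (hξ1 : ∀ k ω, ξ k ω = 1 ∨ ξ k ω = -1) (hξ0 : ∀ k, ∫ ω, ξ k ω ∂P = 0)
    {a : ℕ → Ω → ℝ} (ha : ∀ k, Measurable[ℱ k] (a k)) {C : ℝ}
    (hC : ∀ n ω, ∑ k ∈ Finset.range n, a k ω ^ 2 ≤ C) (n : ℕ) :
    ‖∫ ω, Complex.exp (((∑ k ∈ Finset.range n, a k ω * ξ k ω : ℝ) : ℂ) * Complex.I)
        * (Real.exp ((∑ k ∈ Finset.range n, a k ω ^ 2) / 2) : ℂ) ∂P - 1‖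
      ≤ 2 * Real.exp (C / 2) * ∑ k ∈ Finset.range n, ∫ ω, a k ω ^ 4 ∂P := by
  set U : ℕ → Ω → ℂ := fun n ω =>
    Complex.exp (((∑ k ∈ Finset.range n, a k ω * ξ k ω : ℝ) : ℂ) * Complex.I)
        * (Real.exp ((∑ k ∈ Finset.range n, a k ω ^ 2) / 2) : ℂ) with hU
  have haP : ∀ k, Measurable (a k) := fun k => (ha k).mono (ℱ.le k) le_rfl
  have hξP : ∀ k, Measurable (ξ k) := fun k => (hξm k).mono (ℱ.le _) le_rfl
  have hUm : ∀ n, Measurable[ℱ n] (U n) := by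
    intro n
    have h1 : Measurable[ℱ n] fun ω => ∑ k ∈ Finset.range n, a k ω * ξ k ω := by
      refine Finset.measurable_fun_sum _ fun k hk => ?_
      have hk' := Finset.mem_range.1 hk
      exact ((ha k).mono (ℱ.mono hk'.le) le_rfl).mul ((hξm k).mono (ℱ.mono hk') le_rfl)
    have h2 : Measurable[ℱ n] fun ω => ∑ k ∈ Finset.range n, a k ω ^ 2 := by
      refine Finset.measurable_fun_sum _ fun k hk => ?_
      exact ((ha k).mono (ℱ.mono (Finset.mem_range.1 hk).le) le_rfl).pow_const 2
    exact (Complex.measurable_exp.comp ((Complex.measurable_ofReal.comp h1).mul_const _)).mul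
      (Complex.measurable_ofReal.comp (Real.measurable_exp.comp (h2.div_const 2)))
  have hUn : ∀ n ω, ‖U n ω‖ = Real.exp ((∑ k ∈ Finset.range n, a k ω ^ 2) / 2) := by
    intro n ω
    simp only [hU]
    rw [norm_mul, Complex.norm_exp_ofReal_mul_I, one_mul, Complex.norm_real,
      Real.norm_of_nonneg (Real.exp_pos _).le]
  have hUb : ∀ n ω, ‖U n ω‖ ≤ Real.exp (C / 2) := fun n ω => by
    rw [hUn]; exact Real.exp_le_exp.2 (by linarith [hC n ω])
  have hUi : ∀ n, Integrable (U n) P := fun n =>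
    Integrable.of_bound ((hUm n).mono (ℱ.le n) le_rfl).aestronglyMeasurable _ (ae_of_all _ (hUb n))
  have hae : ∀ k ω, Real.exp (a k ω ^ 2 / 2) ≤ Real.exp (C / 2) := fun k ω => by
    refine Real.exp_le_exp.2 ?_
    have := Finset.single_le_sum (f := fun k => a k ω ^ 2) (fun _ _ => sq_nonneg _)
      (Finset.self_mem_range_succ k)
    linarith [hC (k + 1) ω]
  have hC0 : ∀ k ω, a k ω ^ 2 ≤ C := fun k ω =>
    (Finset.single_le_sum (f := fun k => a k ω ^ 2) (fun _ _ => sq_nonneg _)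
      (Finset.self_mem_range_succ k)).trans (hC (k + 1) ω)
  have ha4 : ∀ k, Integrable (fun ω => a k ω ^ 4) P := fun k =>
    Integrable.of_bound ((haP k).pow_const 4).aestronglyMeasurable (C ^ 2) (ae_of_all _ fun ω => by
      rw [Real.norm_of_nonneg (by positivity)]
      nlinarith [hC0 k ω, sq_nonneg (a k ω)])
  have hstep : ∀ n, ‖∫ ω, U (n + 1) ω ∂P - ∫ ω, U n ω ∂P‖
      ≤ 2 * Real.exp (C / 2) * ∫ ω, a n ω ^ 4 ∂P := by
    intro n
    set p : Ω → ℂ := fun ω => U n ω * ((Real.cos (a n ω) * Real.exp (a n ω ^ 2 / 2) - 1 : ℝ) : ℂ)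
      with hp
    set q : Ω → ℂ := fun ω =>
      U n ω * ((Real.sin (a n ω) * Real.exp (a n ω ^ 2 / 2) : ℝ) : ℂ) * Complex.I with hq
    -- `exp (i a ξ) = cos a + i ξ sin a` because `ξ = ±1`
    have hdec : ∀ ω, U (n + 1) ω - U n ω = p ω + q ω * (ξ n ω : ℂ) := by
      intro ω
      have hexp : Complex.exp (((a n ω * ξ n ω : ℝ) : ℂ) * Complex.I)
          = (Real.cos (a n ω) : ℂ) + (Real.sin (a n ω) : ℂ) * (ξ n ω : ℂ) * Complex.I := by
        rw [Complex.exp_mul_I, ← Complex.ofReal_cos, ← Complex.ofReal_sin]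
        rcases hξ1 n ω with h | h <;> simp [h]
      have hfac : U (n + 1) ω = U n ω * (Complex.exp (((a n ω * ξ n ω : ℝ) : ℂ) * Complex.I)
          * (Real.exp (a n ω ^ 2 / 2) : ℂ)) := by
        simp only [hU, Finset.sum_range_succ, add_div, Real.exp_add, Complex.ofReal_add, add_mul,
          Complex.exp_add, Complex.ofReal_mul]
        ring
      rw [hfac, hexp]
      simp only [hp, hq]
      push_cast
      ring
    have hpm : Measurable p := by
      have := (hUm n).mono (ℱ.le n) le_rfl
      have := haP n
      fun_prop
    have hqm : Measurable[ℱ n] q := by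
      refine ((hUm n).mul (Complex.measurable_ofReal.comp ?_)).mul_const _
      exact (Real.measurable_sin.comp (ha n)).mul
        (Real.measurable_exp.comp (((ha n).pow_const 2).div_const 2))
    have hpb : ∀ ω, ‖p ω‖ ≤ 2 * Real.exp (C / 2) * a n ω ^ 4 := by
      intro ω
      have h1 := abs_cos_mul_exp_sub_one_le (a n ω)
      have h2 : Real.exp ((∑ k ∈ Finset.range n, a k ω ^ 2) / 2) * Real.exp (a n ω ^ 2 / 2)
          ≤ Real.exp (C / 2) := by
        rw [← Real.exp_add, ← add_div, ← Finset.sum_range_succ (fun k => a k ω ^ 2)]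
        exact Real.exp_le_exp.2 (by linarith [hC (n + 1) ω])
      simp only [hp]
      rw [norm_mul, hUn, Complex.norm_real, Real.norm_eq_abs]
      calc _ ≤ Real.exp ((∑ k ∈ Finset.range n, a k ω ^ 2) / 2)
            * (2 * Real.exp (a n ω ^ 2 / 2) * a n ω ^ 4) := by gcongr
        _ = 2 * (Real.exp ((∑ k ∈ Finset.range n, a k ω ^ 2) / 2) * Real.exp (a n ω ^ 2 / 2))
            * a n ω ^ 4 := by ring
        _ ≤ _ := by gcongr
    have hqb : ∀ ω, ‖q ω‖ ≤ Real.exp (C / 2) * Real.exp (C / 2) := by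
      intro ω
      simp only [hq]
      rw [norm_mul, norm_mul, Complex.norm_I, mul_one, Complex.norm_real, Real.norm_eq_abs,
        abs_mul, abs_of_pos (Real.exp_pos _)]
      refine mul_le_mul (hUb n ω) ?_ (by positivity) (by positivity)
      exact (mul_le_of_le_one_left (Real.exp_pos _).le (Real.abs_sin_le_one _)).trans (hae n ω)
    have hpi : Integrable p P := Integrable.mono' ((ha4 n).const_mul _) hpm.aestronglyMeasurable
      (ae_of_all _ hpb)
    have hqm' : Measurable q := hqm.mono (ℱ.le n) le_rfl
    have hξc : Measurable fun ω => (ξ n ω : ℂ) := Complex.measurable_ofReal.comp (hξP n)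
    have hqξ : Integrable (fun ω => q ω * (ξ n ω : ℂ)) P := by
      refine Integrable.of_bound (hqm'.mul hξc).aestronglyMeasurable
        (Real.exp (C / 2) * Real.exp (C / 2)) (ae_of_all _ fun ω => ?_)
      have : ‖(ξ n ω : ℂ)‖ = 1 := by rcases hξ1 n ω with h | h <;> simp [h]
      rw [norm_mul, this, mul_one]
      exact hqb ω
    have hq0 : ∫ ω, q ω * (ξ n ω : ℂ) ∂P = 0 := by
      have hI : IndepFun q (fun ω => (ξ n ω : ℂ)) P :=
        indepFun_of_indep (hξi n) hqm (Complex.measurable_ofReal.comp (comap_measurable _))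
      rw [hI.integral_fun_mul_eq_mul_integral hqm'.aestronglyMeasurable hξc.aestronglyMeasurable,
        integral_complex_ofReal, hξ0]
      simp
    rw [← integral_sub (hUi _) (hUi _), integral_congr_ae (ae_of_all _ hdec),
      integral_add hpi hqξ, hq0, add_zero, ← integral_const_mul]
    exact norm_integral_le_of_norm_le ((ha4 n).const_mul _) (ae_of_all _ hpb)
  induction n with
  | zero => simp
  | succ n ih =>
    have : ∫ ω, U (n + 1) ω ∂P - 1
        = (∫ ω, U (n + 1) ω ∂P - ∫ ω, U n ω ∂P) + (∫ ω, U n ω ∂P - 1) := by ring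
    rw [Finset.sum_range_succ, mul_add]
    change ‖∫ ω, U (n + 1) ω ∂P - 1‖ ≤ _
    rw [this]
    refine (norm_add_le _ _).trans ?_
    have := hstep n
    change ‖∫ ω, U n ω ∂P - 1‖ ≤ _ at ih
    linarith

/-- Conclusion of the central limit theorem at the level of characteristic functions. -/
lemma tendsto_integral_cexp_sum_mul_sign
    (hξm : ∀ k, Measurable[ℱ (k + 1)] (ξ k))
    (hξi : ∀ k, Indep (ℱ k) (MeasurableSpace.comap (ξ k) inferInstance) P)
    (hξ1 : ∀ k ω, ξ k ω = 1 ∨ ξ k ω = -1) (hξ0 : ∀ k, ∫ ω, ξ k ω ∂P = 0)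
    {A : ℕ → Ω → ℝ} (hA : ∀ k, Measurable[ℱ k] (A k))
    (hid : ∀ k, IdentDistrib (A k) (A 0) P P) (hint : Integrable (fun ω => A 0 ω ^ 2) P)
    {v : ℝ} (hv : 0 ≤ v)
    (hlln : Tendsto (fun n : ℕ => ∫ ω, |(∑ k ∈ Finset.range n, A k ω ^ 2) / n - v| ∂P)
      atTop (nhds 0)) (θ : ℝ) :
    Tendsto (fun n : ℕ => ∫ ω, Complex.exp
      (((θ * ((√n)⁻¹ * ∑ k ∈ Finset.range n, A k ω * ξ k ω) : ℝ) : ℂ) * Complex.I) ∂P) atTop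
      (nhds (Real.exp (-(θ ^ 2 * v / 2)) : ℂ)) := by
  have hAP : ∀ k, Measurable (A k) := fun k => (hA k).mono (ℱ.le k) le_rfl
  have hξP : ∀ k, Measurable (ξ k) := fun k => (hξm k).mono (ℱ.le _) le_rfl
  have hAi : ∀ k, Integrable (fun ω => A k ω ^ 2) P := fun k => (hid k).sq.integrable_iff.2 hint
  set C : ℝ := θ ^ 2 * (v + 1) with hCdef
  have hC0 : 0 ≤ C := by positivity
  set K : ℝ := 2 + Real.exp (C / 2) * (θ ^ 2 * (2 * v + 1)) with hK
  -- Lindeberg's condition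
  have hlind : Tendsto (fun n : ℕ => ∫ ω, θ ^ 2 * A 0 ω ^ 2 * min (θ ^ 2 * A 0 ω ^ 2 / n) C ∂P)
      atTop (nhds 0) := by
    rw [← integral_zero Ω ℝ (μ := P)]
    refine tendsto_integral_of_dominated_convergence (fun ω => θ ^ 2 * A 0 ω ^ 2 * C)
      (fun n => ?_) ((hint.const_mul _).mul_const _) (fun n => ae_of_all _ fun ω => ?_)
      (ae_of_all _ fun ω => ?_)
    · have := hAP 0
      exact Measurable.aestronglyMeasurable (by fun_prop)
    · rw [Real.norm_of_nonneg (mul_nonneg (by positivity) (le_min (by positivity) hC0))]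
      exact mul_le_mul_of_nonneg_left (min_le_right _ _) (by positivity)
    · have h1 : Tendsto (fun n : ℕ => θ ^ 2 * A 0 ω ^ 2 / n) atTop (nhds 0) :=
        tendsto_const_div_atTop_nhds_zero_nat _
      have h2 := (h1.min (tendsto_const_nhds (x := C))).const_mul (θ ^ 2 * A 0 ω ^ 2)
      rwa [min_eq_left hC0, mul_zero] at h2
  have hbound : Tendsto (fun n : ℕ =>
      K * ∫ ω, |(∑ k ∈ Finset.range n, A k ω ^ 2) / n - v| ∂P
      + 2 * Real.exp (C / 2) * ∫ ω, θ ^ 2 * A 0 ω ^ 2 * min (θ ^ 2 * A 0 ω ^ 2 / n) C ∂P)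
      atTop (nhds 0) := by
    simpa using (hlln.const_mul K).add (hlind.const_mul (2 * Real.exp (C / 2)))
  rw [tendsto_iff_norm_sub_tendsto_zero]
  refine squeeze_zero' (Eventually.of_forall fun n => norm_nonneg _) ?_ hbound
  filter_upwards [eventually_gt_atTop 0] with n hn
  have hn' : (0 : ℝ) < n := by exact_mod_cast hn
  have hsn : (√(n : ℝ))⁻¹ ^ 2 = (n : ℝ)⁻¹ := by rw [inv_pow, Real.sq_sqrt hn'.le]
  set a : ℕ → Ω → ℝ := fun k ω =>
    θ * ((√n)⁻¹ * stopSq ((v + 1) * n) (fun j => A j ω) k) with hadef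
  have ham : ∀ k, Measurable[ℱ k] (a k) := by
    intro k
    refine Measurable.const_mul (Measurable.const_mul ?_ _) _
    refine Measurable.ite ?_ (hA k) measurable_const
    refine measurableSet_le (Finset.measurable_fun_sum _ fun j hj => ?_) measurable_const
    exact ((hA j).mono (ℱ.mono (by simpa [Nat.lt_succ_iff] using hj)) le_rfl).pow_const 2
  have hasq : ∀ k ω, a k ω ^ 2
      = θ ^ 2 / n * stopSq ((v + 1) * n) (fun j => A j ω) k ^ 2 := by
    intro k ω
    simp only [hadef]
    rw [mul_pow, mul_pow, hsn]
    ring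
  have hsum : ∀ m ω, ∑ k ∈ Finset.range m, a k ω ^ 2 ≤ C := by
    intro m ω
    simp_rw [hasq]
    rw [← Finset.mul_sum]
    calc _ ≤ θ ^ 2 / n * ((v + 1) * n) := by
          gcongr
          exact sum_stopSq_sq_le (by positivity) _ _
      _ = C := by rw [hCdef]; field_simp
  have ha2 : ∀ k ω, a k ω ^ 2 ≤ θ ^ 2 * A k ω ^ 2 / n := by
    intro k ω
    rw [hasq, mul_div_right_comm]
    gcongr ?_ * ?_
    exact stopSq_sq_le _ _ _
  have haC : ∀ k ω, a k ω ^ 2 ≤ C := fun k ω =>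
    (Finset.single_le_sum (f := fun k => a k ω ^ 2) (fun _ _ => sq_nonneg _)
      (Finset.self_mem_range_succ k)).trans (hsum (k + 1) ω)
  have h4 : ∑ k ∈ Finset.range n, ∫ ω, a k ω ^ 4 ∂P
      ≤ ∫ ω, θ ^ 2 * A 0 ω ^ 2 * min (θ ^ 2 * A 0 ω ^ 2 / n) C ∂P := by
    have hk : ∀ k ∈ Finset.range n, ∫ ω, a k ω ^ 4 ∂P
        ≤ (∫ ω, θ ^ 2 * A 0 ω ^ 2 * min (θ ^ 2 * A 0 ω ^ 2 / n) C ∂P) / n := by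
      intro k _
      have hu : Measurable fun x : ℝ => θ ^ 2 * x ^ 2 * min (θ ^ 2 * x ^ 2 / n) C := by fun_prop
      have := ((hid k).comp hu).integral_eq
      simp only [Function.comp_def] at this
      rw [← this, ← integral_div]
      refine integral_mono_of_nonneg (ae_of_all _ fun ω => by positivity) ?_
        (ae_of_all _ fun ω => ?_)
      · refine Integrable.div_const ?_ _
        refine Integrable.mono' (((hAi k).const_mul (θ ^ 2)).mul_const C)
          (hu.comp (hAP k)).aestronglyMeasurable (ae_of_all _ fun ω => ?_)
        rw [Real.norm_of_nonneg (mul_nonneg (by positivity) (le_min (by positivity) hC0))]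
        exact mul_le_mul_of_nonneg_left (min_le_right _ _) (by positivity)
      · change a k ω ^ 4 ≤ θ ^ 2 * A k ω ^ 2 * min (θ ^ 2 * A k ω ^ 2 / n) C / n
        have : a k ω ^ 4 = a k ω ^ 2 * a k ω ^ 2 := by ring
        rw [this, mul_div_right_comm]
        exact mul_le_mul (ha2 k ω) (le_min (ha2 k ω) (haC k ω)) (sq_nonneg _) (by positivity)
    refine (Finset.sum_le_sum hk).trans_eq ?_
    rw [Finset.sum_const, Finset.card_range, nsmul_eq_mul]
    field_simp
  have hmart := norm_integral_cexp_mul_exp_sub_one_le hξm hξi hξ1 hξ0 ham hsum n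
  set g : Ω → ℂ := fun ω => Complex.exp
    (((θ * ((√n)⁻¹ * ∑ k ∈ Finset.range n, A k ω * ξ k ω) : ℝ) : ℂ) * Complex.I) with hg
  set T : Ω → ℝ := fun ω => ∑ k ∈ Finset.range n, a k ω * ξ k ω with hT
  set D : Ω → ℝ := fun ω => ∑ k ∈ Finset.range n, a k ω ^ 2 with hD
  set δ : Ω → ℝ := fun ω => |(∑ k ∈ Finset.range n, A k ω ^ 2) / n - v| with hδ
  set s : ℝ := θ ^ 2 * v with hs
  have haP : ∀ k, Measurable (a k) := fun k => (ham k).mono (ℱ.le k) le_rfl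
  have hTm : Measurable T := Finset.measurable_fun_sum _ fun k _ => (haP k).mul (hξP k)
  have hDm : Measurable D := Finset.measurable_fun_sum _ fun k _ => (haP k).pow_const 2
  have hgm : Measurable g := by
    have : Measurable fun ω => ∑ k ∈ Finset.range n, A k ω * ξ k ω :=
      Finset.measurable_fun_sum _ fun k _ => (hAP k).mul (hξP k)
    fun_prop
  have hgi : Integrable g P := Integrable.of_bound hgm.aestronglyMeasurable 1
    (ae_of_all _ fun ω => by simp only [hg]; rw [Complex.norm_exp_ofReal_mul_I])
  have hWi : Integrable (fun ω => Complex.exp ((T ω : ℂ) * Complex.I)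
      * (Real.exp (D ω / 2) : ℂ)) P := by
    refine Integrable.of_bound (Measurable.aestronglyMeasurable (by fun_prop)) (Real.exp (C / 2))
      (ae_of_all _ fun ω => ?_)
    rw [norm_mul, Complex.norm_exp_ofReal_mul_I, one_mul, Complex.norm_real,
      Real.norm_of_nonneg (Real.exp_pos _).le]
    exact Real.exp_le_exp.2 (by linarith [hsum n ω])
  have hδi : Integrable δ P := (((integrable_finsetSum _ fun k _ => hAi k).div_const _).sub
    (integrable_const _)).abs
  have hDs : ∀ ω, |D ω - s| ≤ θ ^ 2 * (2 * v + 1) * δ ω ∧ ‖g ω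
      - Complex.exp ((T ω : ℂ) * Complex.I)‖ ≤ 2 * δ ω := by
    intro ω
    by_cases h : ∑ j ∈ Finset.range n, A j ω ^ 2 ≤ (v + 1) * n
    · have hst : ∀ k ∈ Finset.range n, a k ω = θ * ((√n)⁻¹ * A k ω) := fun k hk => by
        simp only [hadef]; rw [stopSq_eq h (Finset.mem_range.1 hk)]
      constructor
      · have : D ω - s = θ ^ 2 * ((∑ k ∈ Finset.range n, A k ω ^ 2) / n - v) := by
          simp only [hD, hs]
          rw [Finset.sum_congr rfl fun k hk => by rw [hst k hk, mul_pow, mul_pow, hsn],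
            ← Finset.mul_sum, ← Finset.mul_sum]
          ring
        rw [this, abs_mul, abs_of_nonneg (sq_nonneg θ), mul_assoc]
        refine mul_le_mul_of_nonneg_left ?_ (sq_nonneg θ)
        exact le_mul_of_one_le_left (abs_nonneg _) (by linarith)
      · have : T ω = θ * ((√n)⁻¹ * ∑ k ∈ Finset.range n, A k ω * ξ k ω) := by
          simp only [hT]
          rw [Finset.sum_congr rfl fun k hk => by rw [hst k hk], Finset.mul_sum, Finset.mul_sum]
          exact Finset.sum_congr rfl fun k _ => by ring
        simp only [hg]
        rw [this, sub_self, norm_zero]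
        positivity
    · have hδ1 : 1 ≤ δ ω := by
        rw [not_le] at h
        refine le_trans ?_ (le_abs_self _)
        rw [le_sub_iff_add_le, le_div_iff₀ hn']
        linarith
      have hD0 : 0 ≤ D ω := Finset.sum_nonneg fun k _ => sq_nonneg _
      have hs0 : 0 ≤ s := by positivity
      constructor
      · calc |D ω - s| ≤ C + s := by
              rw [abs_le]; constructor <;> linarith [hsum n ω]
          _ = θ ^ 2 * (2 * v + 1) := by rw [hCdef, hs]; ring
          _ ≤ _ := le_mul_of_one_le_right (by positivity) hδ1
      · refine (norm_sub_le _ _).trans ?_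
        simp only [hg]
        rw [Complex.norm_exp_ofReal_mul_I, Complex.norm_exp_ofReal_mul_I]
        linarith
  have hpt : ∀ ω, ‖g ω - (Real.exp (-(s / 2)) : ℂ) * (Complex.exp ((T ω : ℂ) * Complex.I)
      * (Real.exp (D ω / 2) : ℂ))‖ ≤ K * δ ω := by
    intro ω
    obtain ⟨h1, h2⟩ := hDs ω
    have h3 : g ω - (Real.exp (-(s / 2)) : ℂ) * (Complex.exp ((T ω : ℂ) * Complex.I)
        * (Real.exp (D ω / 2) : ℂ)) = (g ω - Complex.exp ((T ω : ℂ) * Complex.I))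
          + Complex.exp ((T ω : ℂ) * Complex.I) * ((1 - Real.exp ((D ω - s) / 2) : ℝ) : ℂ) := by
      have : Real.exp ((D ω - s) / 2) = Real.exp (-(s / 2)) * Real.exp (D ω / 2) := by
        rw [← Real.exp_add]; congr 1; ring
      rw [this]
      push_cast
      ring
    have h4 : |1 - Real.exp ((D ω - s) / 2)| ≤ Real.exp (C / 2) * |(D ω - s) / 2| := by
      refine abs_one_sub_exp_le (by positivity) ?_
      have : 0 ≤ s := by positivity
      linarith [hsum n ω]
    have h5 : |(D ω - s) / 2| ≤ θ ^ 2 * (2 * v + 1) * δ ω := by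
      rw [abs_div, abs_two]
      linarith [abs_nonneg (D ω - s)]
    rw [h3]
    refine (norm_add_le _ _).trans ?_
    rw [norm_mul, Complex.norm_exp_ofReal_mul_I, one_mul, Complex.norm_real, Real.norm_eq_abs]
    have h6 : Real.exp (C / 2) * |(D ω - s) / 2|
        ≤ Real.exp (C / 2) * (θ ^ 2 * (2 * v + 1) * δ ω) := by gcongr
    rw [hK, add_mul]
    linarith
  have hfin : ∫ ω, g ω ∂P - (Real.exp (-(s / 2)) : ℂ)
      = ∫ ω, (g ω - (Real.exp (-(s / 2)) : ℂ) * (Complex.exp ((T ω : ℂ) * Complex.I)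
        * (Real.exp (D ω / 2) : ℂ))) ∂P
        + (Real.exp (-(s / 2)) : ℂ) * (∫ ω, Complex.exp ((T ω : ℂ) * Complex.I)
        * (Real.exp (D ω / 2) : ℂ) ∂P - 1) := by
    rw [integral_sub hgi (hWi.const_mul _), integral_const_mul]
    ring
  rw [hfin]
  refine (norm_add_le _ _).trans (add_le_add ?_ ?_)
  · rw [← integral_const_mul]
    exact norm_integral_le_of_norm_le (hδi.const_mul K) (ae_of_all _ hpt)
  · rw [norm_mul, Complex.norm_real, Real.norm_of_nonneg (Real.exp_pos _).le]
    have he : Real.exp (-(s / 2)) ≤ 1 := Real.exp_le_one_iff.2 (by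
      have : 0 ≤ s := by positivity
      linarith)
    refine (mul_le_of_le_one_left (norm_nonneg _) he).trans (hmart.trans ?_)
    gcongr

end SignCLT

/-! ### The mean absolute deviation near a median -/

section AbsDeviation

/-- The sign attached to the median: `1` for `z ≤ 0` and `-1` for `z > 0`. With this choice at `0`,
`y * leSign z` is the linear term of `|z - y| - |z|` for every `z`, including `z = 0`. -/
noncomputable def leSign (z : ℝ) : ℝ := if z ≤ 0 then 1 else -1

lemma leSign_eq (z : ℝ) : leSign z = 1 ∨ leSign z = -1 := by
  unfold leSign
  split_ifs <;> simp

lemma measurable_leSign : Measurable leSign :=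
  Measurable.ite measurableSet_Iic measurable_const measurable_const

/-- `leSign (z - y)` is a subgradient of the convex function `|z - ·|` at `y`. -/
lemma abs_sub_add_mul_leSign_le (z y x : ℝ) :
    |z - y| + (x - y) * leSign (z - y) ≤ |z - x| := by
  unfold leSign
  split_ifs with h
  · rw [abs_of_nonpos h]
    linarith [neg_abs_le (z - x)]
  · rw [abs_of_pos (not_le.1 h)]
    linarith [le_abs_self (z - x)]

/-- The expected increment `𝔼[|Z - y| - |Z|]` of the absolute deviation, for `Z` of law `μ`. -/
noncomputable def absShift (μ : Measure ℝ) (y : ℝ) : ℝ := ∫ z, (|z - y| - |z|) ∂μ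

lemma abs_abs_sub_sub_abs_le (z y : ℝ) : |(|z - y| - |z|)| ≤ |y| := by
  have := abs_abs_sub_abs_le_abs_sub (z - y) z
  rwa [sub_sub_cancel_left, abs_neg] at this

@[simp]
lemma absShift_zero (μ : Measure ℝ) : absShift μ 0 = 0 := by simp [absShift]

variable (μ : Measure ℝ) [IsProbabilityMeasure μ]

lemma integrable_abs_sub_sub_abs (y : ℝ) : Integrable (fun z => |z - y| - |z|) μ :=
  Integrable.of_bound (Measurable.aestronglyMeasurable (by fun_prop)) |y|
    (ae_of_all _ fun z => abs_abs_sub_sub_abs_le z y)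

lemma integrable_leSign_sub (y : ℝ) : Integrable (fun z => leSign (z - y)) μ :=
  Integrable.of_bound
    (measurable_leSign.comp (measurable_id.sub_const y)).aestronglyMeasurable 1
    (ae_of_all _ fun z => by rcases leSign_eq (z - y) with h | h <;> simp [h])

lemma integral_leSign_sub (y : ℝ) : ∫ z, leSign (z - y) ∂μ = 2 * cdf μ y - 1 := by
  have h : ∀ z, leSign (z - y) = 2 * (Iic y).indicator 1 z - 1 := by
    intro z
    by_cases hz : z ≤ y
    · simp [leSign, hz]; norm_num
    · simp [leSign, hz]
  simp_rw [h]
  rw [integral_sub _ (integrable_const _), integral_const_mul, integral_indicator_one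
    measurableSet_Iic, cdf_eq_real]
  · simp
  · exact ((integrable_const (1 : ℝ)).indicator measurableSet_Iic).const_mul 2

lemma abs_absShift_le (y : ℝ) : |absShift μ y| ≤ |y| := by
  have := norm_integral_le_of_norm_le_const (μ := μ) (f := fun z => |z - y| - |z|) (C := |y|)
    (ae_of_all _ fun z => abs_abs_sub_sub_abs_le z y)
  simpa [absShift] using this

lemma measurable_absShift : Measurable (absShift μ) := by
  have : StronglyMeasurable (Function.uncurry fun y z : ℝ => |z - y| - |z|) :=
    Measurable.stronglyMeasurable (by unfold Function.uncurry; fun_prop)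
  exact this.integral_prod_right.measurable

lemma absShift_add_mul_le (y x : ℝ) :
    absShift μ y + (x - y) * (2 * cdf μ y - 1) ≤ absShift μ x := by
  unfold absShift
  rw [← integral_leSign_sub, ← integral_const_mul,
    ← integral_add (integrable_abs_sub_sub_abs μ y) ((integrable_leSign_sub μ y).const_mul _)]
  refine integral_mono ((integrable_abs_sub_sub_abs μ y).add
    ((integrable_leSign_sub μ y).const_mul _)) (integrable_abs_sub_sub_abs μ x) fun z => ?_
  have := abs_sub_add_mul_leSign_le z y x
  change |z - y| - |z| + (x - y) * leSign (z - y) ≤ _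
  linarith

lemma hasDerivAt_absShift {y : ℝ} (h : ContinuousAt (cdf μ) y) :
    HasDerivAt (absShift μ) (2 * cdf μ y - 1) y := by
  rw [hasDerivAt_iff_isLittleO, Asymptotics.isLittleO_iff]
  intro c hc
  obtain ⟨δ, hδ, hδ'⟩ := Metric.continuousAt_iff.1 h (c / 2) (by positivity)
  filter_upwards [Metric.ball_mem_nhds y hδ] with x hx
  have h1 := absShift_add_mul_le μ y x
  have h2 := absShift_add_mul_le μ x y
  have h3 := hδ' hx
  rw [Real.dist_eq] at h3
  have h4 : (x - y) * (2 * (cdf μ x - cdf μ y)) ≤ c * |x - y| := by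
    refine (le_abs_self _).trans ?_
    rw [abs_mul, abs_mul, abs_two]
    nlinarith [abs_nonneg (x - y)]
  rw [Real.norm_eq_abs, Real.norm_eq_abs, smul_eq_mul, abs_of_nonneg (by linarith)]
  linarith

/-- Second order expansion of the mean absolute deviation at a median with density `d`. -/
lemma absShift_sub_isLittleO {d ε : ℝ} (hε : 0 < ε)
    (hcont : ∀ x ∈ Ioo (-ε) ε, ContinuousAt (cdf μ) x) (hd : HasDerivAt (cdf μ) d 0)
    (hmed : cdf μ 0 = 1 / 2) :
    (fun y => absShift μ y - d * y ^ 2) =o[nhds 0] fun y => y ^ 2 := by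
  rw [Asymptotics.isLittleO_iff]
  intro c hc
  rw [hasDerivAt_iff_isLittleO, Asymptotics.isLittleO_iff] at hd
  obtain ⟨δ, hδ, hδ'⟩ := Metric.eventually_nhds_iff.1 (hd (by positivity : 0 < c / 2))
  filter_upwards [Metric.ball_mem_nhds 0 (lt_min hδ hε)] with y hy
  rw [Metric.mem_ball, Real.dist_eq, sub_zero] at hy
  have hmem : ∀ x ∈ Icc (-|y|) |y|, |x| ≤ |y| := fun x hx => abs_le.2 hx
  have hder : ∀ x ∈ Icc (-|y|) |y|, HasDerivWithinAt (fun y => absShift μ y - d * y ^ 2)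
      (2 * cdf μ x - 1 - d * (2 * x)) (Icc (-|y|) |y|) x := by
    intro x hx
    have hx' := (hmem x hx).trans_lt (hy.trans_le (min_le_right _ _))
    have h1 := hasDerivAt_absShift μ (hcont x (abs_lt.1 hx'))
    have h2 := ((hasDerivAt_pow 2 x).const_mul d)
    exact ((h1.sub h2).congr_deriv (by simp)).hasDerivWithinAt
  have hbd : ∀ x ∈ Icc (-|y|) |y|, ‖2 * cdf μ x - 1 - d * (2 * x)‖ ≤ c * |y| := by
    intro x hx
    have h1 := hδ' (y := x) (by
      rw [Real.dist_eq, sub_zero]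
      exact (hmem x hx).trans_lt (hy.trans_le (min_le_left _ _)))
    rw [hmed, sub_zero, smul_eq_mul, Real.norm_eq_abs, Real.norm_eq_abs] at h1
    have h2 : 2 * cdf μ x - 1 - d * (2 * x) = 2 * (cdf μ x - 1 / 2 - x * d) := by ring
    rw [h2, Real.norm_eq_abs, abs_mul, abs_two]
    have := mul_le_mul_of_nonneg_left (hmem x hx) hc.le
    linarith
  have := (convex_Icc (-|y|) |y|).norm_image_sub_le_of_norm_hasDerivWithin_le hder hbd
    (x := 0) (y := y) (by simp) ⟨neg_abs_le y, le_abs_self y⟩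
  simp only [absShift_zero, sub_zero, ne_eq, OfNat.ofNat_ne_zero, not_false_eq_true, zero_pow,
    mul_zero] at this
  rw [norm_pow, sq ‖y‖, ← mul_assoc]
  simpa using this

lemma exists_abs_absShift_le_mul_sq {d : ℝ}
    (h : (fun y => absShift μ y - d * y ^ 2) =o[nhds 0] fun y => y ^ 2) :
    ∃ C, 0 ≤ C ∧ ∀ y, |absShift μ y| ≤ C * y ^ 2 := by
  rw [Asymptotics.isLittleO_iff] at h
  obtain ⟨δ, hδ, hδ'⟩ := Metric.eventually_nhds_iff.1 (h one_pos)
  refine ⟨max (1 + |d|) δ⁻¹, le_max_of_le_left (by positivity), fun y => ?_⟩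
  rcases lt_or_ge |y| δ with hy | hy
  · have h1 := hδ' (y := y) (by simpa [Real.dist_eq] using hy)
    rw [Real.norm_eq_abs, Real.norm_eq_abs, abs_of_nonneg (sq_nonneg y)] at h1
    have h2 : |absShift μ y| ≤ |absShift μ y - d * y ^ 2| + |d * y ^ 2| := by
      have := abs_add_le (absShift μ y - d * y ^ 2) (d * y ^ 2)
      rwa [sub_add_cancel] at this
    rw [abs_mul, abs_of_nonneg (sq_nonneg y)] at h2
    calc _ ≤ (1 + |d|) * y ^ 2 := by linarith
      _ ≤ _ := by gcongr; exact le_max_left _ _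
  · calc |absShift μ y| ≤ |y| := abs_absShift_le μ y
      _ ≤ δ⁻¹ * y ^ 2 := by
        rw [← sq_abs y, inv_mul_eq_div, le_div_iff₀ hδ, sq]
        exact mul_le_mul_of_nonneg_left hy (abs_nonneg y)
      _ ≤ _ := by gcongr; exact le_max_right _ _

/-- The centred remainder in `|z - y| - |z| = y * leSign z + absShift μ y + absRemainder μ y z`. -/
noncomputable def absRemainder (y z : ℝ) : ℝ := |z - y| - |z| - y * leSign z - absShift μ y

lemma measurable_absRemainder : Measurable (Function.uncurry (absRemainder μ)) := by
  have h1 : Measurable fun p : ℝ × ℝ => absShift μ p.1 :=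
    (measurable_absShift μ).comp measurable_fst
  have h2 : Measurable fun p : ℝ × ℝ => leSign p.2 := measurable_leSign.comp measurable_snd
  unfold Function.uncurry absRemainder
  fun_prop

lemma abs_absRemainder_le (y z : ℝ) : |absRemainder μ y z| ≤ 3 * |y| := by
  have h1 := abs_abs_sub_sub_abs_le z y
  have h2 := abs_absShift_le μ y
  have h3 : |y * leSign z| = |y| := by rcases leSign_eq z with h | h <;> simp [h]
  unfold absRemainder
  linarith [abs_sub (|z - y| - |z| - y * leSign z) (absShift μ y),
    abs_sub (|z - y| - |z|) (y * leSign z)]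

variable {μ}

lemma integral_leSign (hmed : cdf μ 0 = 1 / 2) : ∫ z, leSign z ∂μ = 0 := by
  have := integral_leSign_sub μ 0
  simpa [hmed] using this

lemma absShift_nonneg (hmed : cdf μ 0 = 1 / 2) (y : ℝ) : 0 ≤ absShift μ y := by
  simpa [hmed] using absShift_add_mul_le μ 0 y

lemma integral_abs_sub_sub_abs_sub_mul_leSign (hmed : cdf μ 0 = 1 / 2) (y : ℝ) :
    ∫ z, (|z - y| - |z| - y * leSign z) ∂μ = absShift μ y := by
  rw [integral_sub (integrable_abs_sub_sub_abs μ y)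
    ((by simpa using integrable_leSign_sub μ 0 : Integrable leSign μ).const_mul y),
    integral_const_mul, integral_leSign hmed, mul_zero, sub_zero, absShift]

lemma integrable_abs_sub_sub_abs_sub_mul_leSign (y : ℝ) :
    Integrable (fun z => |z - y| - |z| - y * leSign z) μ :=
  (integrable_abs_sub_sub_abs μ y).sub
    ((by simpa using integrable_leSign_sub μ 0 : Integrable leSign μ).const_mul y)

lemma integral_absRemainder (hmed : cdf μ 0 = 1 / 2) (y : ℝ) :
    ∫ z, absRemainder μ y z ∂μ = 0 := by
  unfold absRemainder
  rw [integral_sub (integrable_abs_sub_sub_abs_sub_mul_leSign y) (integrable_const _),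
    integral_abs_sub_sub_abs_sub_mul_leSign hmed]
  simp

/-- The uncentred remainder lies between `0` and `2 * |y|`, so that its second moment is at most
`2 * |y|` times its first moment. -/
lemma integral_absRemainder_sq_le (hmed : cdf μ 0 = 1 / 2) (y : ℝ) :
    ∫ z, absRemainder μ y z ^ 2 ∂μ ≤ 2 * |y| * absShift μ y := by
  have hR : ∀ z, 0 ≤ |z - y| - |z| - y * leSign z ∧ |z - y| - |z| - y * leSign z ≤ 2 * |y| := by
    intro z
    refine ⟨by have := abs_sub_add_mul_leSign_le z 0 y; simp only [sub_zero] at this; linarith, ?_⟩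
    have h1 := (abs_le.1 (abs_abs_sub_sub_abs_le z y)).2
    have h3 : |y * leSign z| = |y| := by rcases leSign_eq z with h | h <;> simp [h]
    linarith [neg_abs_le (y * leSign z)]
  have hG := absShift_nonneg hmed y
  have hi := integrable_abs_sub_sub_abs_sub_mul_leSign (μ := μ) y
  have hpt : ∀ z, absRemainder μ y z ^ 2 ≤ 2 * |y| * (|z - y| - |z| - y * leSign z)
      - 2 * absShift μ y * (|z - y| - |z| - y * leSign z) + absShift μ y ^ 2 := by
    intro z
    obtain ⟨h1, h2⟩ := hR z
    unfold absRemainder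
    nlinarith
  have hi1 : Integrable (fun z => 2 * |y| * (|z - y| - |z| - y * leSign z)
      - 2 * absShift μ y * (|z - y| - |z| - y * leSign z)) μ :=
    (hi.const_mul _).sub (hi.const_mul _)
  refine (integral_mono_of_nonneg (ae_of_all _ fun z => sq_nonneg _)
    (hi1.add (integrable_const _)) (ae_of_all _ hpt)).trans ?_
  simp only [Pi.add_apply]
  rw [integral_add hi1 (integrable_const _), integral_sub (hi.const_mul _) (hi.const_mul _),
    integral_const_mul, integral_const_mul, integral_abs_sub_sub_abs_sub_mul_leSign hmed]
  simp only [integral_const, probReal_univ, one_smul]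
  nlinarith

end AbsDeviation

/-! ### The three parts of the sum -/

section Parts

variable {Ω : Type*} [MeasurableSpace Ω] {P : Measure Ω}

lemma tendsto_inv_sqrt_natCast_mul (x : ℝ) :
    Tendsto (fun n : ℕ => (√(n : ℝ))⁻¹ * x) atTop (nhds 0) := by
  have h : Tendsto (fun n : ℕ => (√(n : ℝ))⁻¹) atTop (nhds 0) :=
    tendsto_inv_atTop_zero.comp (Real.tendsto_sqrt_atTop.comp tendsto_natCast_atTop_atTop)
  simpa using h.mul_const x

lemma natCast_mul_sq_inv_sqrt_mul_le (n : ℕ) (x : ℝ) :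
    n * ((√(n : ℝ))⁻¹ * x) ^ 2 ≤ x ^ 2 := by
  rw [mul_pow, inv_pow, Real.sq_sqrt n.cast_nonneg, ← mul_assoc]
  exact mul_le_of_le_one_left (sq_nonneg x) mul_inv_le_one

/-- If `r y = o(y²)` at `0` and `r y = O(y²)` everywhere, then `n * 𝔼[W * r (Y / √n)] → 0`. -/
lemma tendsto_natCast_mul_integral_mul_comp {W Y : Ω → ℝ} (hW : Measurable W) (hY : Measurable Y)
    (hWY : Integrable (fun ω => W ω * Y ω ^ 2) P) {r : ℝ → ℝ} (hr : Measurable r) {C : ℝ}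
    (hrC : ∀ y, |r y| ≤ C * y ^ 2) (hro : r =o[nhds 0] fun y => y ^ 2) :
    Tendsto (fun n : ℕ => n * ∫ ω, W ω * r ((√(n : ℝ))⁻¹ * Y ω) ∂P) atTop (nhds 0) := by
  simp_rw [← integral_const_mul]
  rw [← integral_zero Ω ℝ (μ := P)]
  have hC : 0 ≤ C := by simpa using (abs_nonneg _).trans (hrC 1)
  refine tendsto_integral_of_dominated_convergence (fun ω => C * |W ω * Y ω ^ 2|)
    (fun n => Measurable.aestronglyMeasurable (by fun_prop)) (hWY.abs.const_mul C)
    (fun n => ae_of_all _ fun ω => ?_) (ae_of_all _ fun ω => ?_)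
  · rw [Real.norm_eq_abs, abs_mul, abs_mul, abs_mul, Nat.abs_cast, abs_of_nonneg (sq_nonneg (Y ω))]
    calc n * (|W ω| * |r ((√(n : ℝ))⁻¹ * Y ω)|)
        ≤ n * (|W ω| * (C * ((√(n : ℝ))⁻¹ * Y ω) ^ 2)) := by
          gcongr
          exact hrC _
      _ = C * (|W ω| * (n * ((√(n : ℝ))⁻¹ * Y ω) ^ 2)) := by ring
      _ ≤ _ := by
          gcongr
          exact natCast_mul_sq_inv_sqrt_mul_le n (Y ω)
  · have h1 := hro.comp_tendsto (tendsto_inv_sqrt_natCast_mul (Y ω))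
    have h2 : (fun n : ℕ => n * (W ω * r ((√(n : ℝ))⁻¹ * Y ω)))
        =o[atTop] fun n : ℕ => (n : ℝ) * ((√(n : ℝ))⁻¹ * Y ω) ^ 2 := by
      refine (Asymptotics.isBigO_refl _ _).mul_isLittleO ?_
      exact h1.const_mul_left (W ω)
    have h3 : (fun n : ℕ => (n : ℝ) * ((√(n : ℝ))⁻¹ * Y ω) ^ 2) =O[atTop] fun _ => (1 : ℝ) := by
      refine Asymptotics.IsBigO.of_bound (Y ω ^ 2) (Eventually.of_forall fun n => ?_)
      rw [Real.norm_of_nonneg (by positivity), norm_one, mul_one]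
      exact natCast_mul_sq_inv_sqrt_mul_le n (Y ω)
    exact (Asymptotics.isLittleO_one_iff ℝ).1 (h2.trans_isBigO h3)

variable [IsProbabilityMeasure P]

/-- Integrating out a variable that is independent of the other argument. -/
lemma integral_comp_prod_of_indepFun {E : Type*} [MeasurableSpace E] {U : Ω → E} {ζ : Ω → ℝ}
    (h : IndepFun U ζ P) (hU : Measurable U) (hζ : Measurable ζ) {g : E × ℝ → ℝ}
    (hg : Measurable g) (hi : Integrable (fun ω => g (U ω, ζ ω)) P) :
    ∫ ω, g (U ω, ζ ω) ∂P = ∫ ω, ∫ z, g (U ω, z) ∂(P.map ζ) ∂P := by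
  have hmap := h.map_prod_eq_prod_map_map hU.aemeasurable hζ.aemeasurable
  have : IsProbabilityMeasure (P.map ζ) := Measure.isProbabilityMeasure_map hζ.aemeasurable
  have hpair : Measurable fun ω => (U ω, ζ ω) := hU.prodMk hζ
  have hi' : Integrable g ((P.map U).prod (P.map ζ)) := by
    rw [← hmap]
    exact (integrable_map_measure hg.aestronglyMeasurable hpair.aemeasurable).2 hi
  rw [← integral_map hpair.aemeasurable hg.aestronglyMeasurable (f := g), hmap,
    integral_prod g hi', integral_map hU.aemeasurable]
  exact hg.stronglyMeasurable.integral_prod_right'.aestronglyMeasurable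

variable {ℱ : Filtration ℕ ‹MeasurableSpace Ω›} {ζ : ℕ → Ω → ℝ} {μ : Measure ℝ}

/-- Second moment of a sum of martingale differences `V k * g (y k) (ζ k)`, with `V k` and `y k`
known before the innovation `ζ k`. -/
lemma integral_sq_sum_mul_le
    (hζm : ∀ k, Measurable[ℱ (k + 1)] (ζ k))
    (hζi : ∀ k, Indep (ℱ k) (MeasurableSpace.comap (ζ k) inferInstance) P)
    (hζμ : ∀ k, P.map (ζ k) = μ)
    {V y : ℕ → Ω → ℝ} (hV : ∀ k, Measurable[ℱ k] (V k)) (hy : ∀ k, Measurable[ℱ k] (y k))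
    (hVy : ∀ k, Integrable (fun ω => V k ω ^ 2 * y k ω ^ 2) P)
    {g : ℝ → ℝ → ℝ} (hg : Measurable (Function.uncurry g)) {C : ℝ}
    (hgC : ∀ y z, |g y z| ≤ C * |y|) (hg0 : ∀ y, ∫ z, g y z ∂μ = 0)
    {q : ℝ → ℝ} (hq : ∀ y, ∫ z, g y z ^ 2 ∂μ ≤ q y)
    (hVq : ∀ k, Integrable (fun ω => V k ω ^ 2 * q (y k ω)) P) (n : ℕ) :
    MemLp (fun ω => ∑ k ∈ Finset.range n, V k ω * g (y k ω) (ζ k ω)) 2 P ∧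
    ∫ ω, (∑ k ∈ Finset.range n, V k ω * g (y k ω) (ζ k ω)) ^ 2 ∂P
      ≤ ∑ k ∈ Finset.range n, ∫ ω, V k ω ^ 2 * q (y k ω) ∂P := by
  have hVP : ∀ k, Measurable (V k) := fun k => (hV k).mono (ℱ.le k) le_rfl
  have hyP : ∀ k, Measurable (y k) := fun k => (hy k).mono (ℱ.le k) le_rfl
  have hζP : ∀ k, Measurable (ζ k) := fun k => (hζm k).mono (ℱ.le _) le_rfl
  set N : ℕ → Ω → ℝ := fun k ω => V k ω * g (y k ω) (ζ k ω) with hN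
  have hNm : ∀ k, Measurable (N k) := fun k =>
    (hVP k).mul (hg.comp ((hyP k).prodMk (hζP k)))
  have hNsq : ∀ k ω, N k ω ^ 2 ≤ C ^ 2 * (V k ω ^ 2 * y k ω ^ 2) := fun k ω => by
    have h1 : |g (y k ω) (ζ k ω)| ^ 2 ≤ (C * |y k ω|) ^ 2 :=
      pow_le_pow_left₀ (abs_nonneg _) (hgC _ _) 2
    rw [sq_abs, mul_pow, sq_abs] at h1
    simp only [hN]
    rw [mul_pow]
    nlinarith [sq_nonneg (V k ω)]
  have hNi : ∀ k, Integrable (fun ω => N k ω ^ 2) P := fun k =>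
    Integrable.mono' ((hVy k).const_mul (C ^ 2)) ((hNm k).pow_const 2).aestronglyMeasurable
      (ae_of_all _ fun ω => by rw [Real.norm_of_nonneg (sq_nonneg _)]; exact hNsq k ω)
  have hNL : ∀ k, MemLp (N k) 2 P := fun k =>
    (memLp_two_iff_integrable_sq (hNm k).aestronglyMeasurable).2 (hNi k)
  have hSL : ∀ n, MemLp (fun ω => ∑ k ∈ Finset.range n, N k ω) 2 P := fun n =>
    memLp_finsetSum _ fun k _ => hNL k
  refine ⟨hSL n, ?_⟩
  have hsq : ∀ k, ∫ ω, N k ω ^ 2 ∂P ≤ ∫ ω, V k ω ^ 2 * q (y k ω) ∂P := by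
    intro k
    have hI : IndepFun (fun ω => (V k ω, y k ω)) (ζ k) P :=
      indepFun_of_indep (hζi k) ((hV k).prodMk (hy k)) (comap_measurable _)
    have hG : Measurable fun p : (ℝ × ℝ) × ℝ => (p.1.1 * g p.1.2 p.2) ^ 2 :=
      (measurable_fst.fst.mul (hg.comp (measurable_fst.snd.prodMk measurable_snd))).pow_const 2
    have := integral_comp_prod_of_indepFun hI ((hVP k).prodMk (hyP k)) (hζP k) hG (hNi k)
    simp only [hN]
    rw [this, hζμ]
    refine integral_mono_of_nonneg (ae_of_all _ fun ω => integral_nonneg fun z => sq_nonneg _)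
      (hVq k) (ae_of_all _ fun ω => ?_)
    simp only [mul_pow, integral_const_mul]
    exact mul_le_mul_of_nonneg_left (hq _) (sq_nonneg _)
  have hcross : ∀ n, ∫ ω, (∑ k ∈ Finset.range n, N k ω) * N n ω ∂P = 0 := by
    intro n
    have hSm : Measurable[ℱ n] fun ω => ∑ k ∈ Finset.range n, N k ω := by
      refine Finset.measurable_fun_sum _ fun k hk => ?_
      have hk' := Finset.mem_range.1 hk
      exact ((hV k).mono (ℱ.mono hk'.le) le_rfl).mul
        (hg.comp (((hy k).mono (ℱ.mono hk'.le) le_rfl).prodMk ((hζm k).mono (ℱ.mono hk') le_rfl)))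
    have hI : IndepFun (fun ω => (∑ k ∈ Finset.range n, N k ω, V n ω, y n ω)) (ζ n) P :=
      indepFun_of_indep (hζi n) (hSm.prodMk ((hV n).prodMk (hy n))) (comap_measurable _)
    have hG : Measurable fun p : (ℝ × ℝ × ℝ) × ℝ => p.1.1 * (p.1.2.1 * g p.1.2.2 p.2) :=
      measurable_fst.fst.mul (measurable_fst.snd.fst.mul
        (hg.comp (measurable_fst.snd.snd.prodMk measurable_snd)))
    have hSi : Integrable (fun ω => (∑ k ∈ Finset.range n, N k ω) * N n ω) P :=
      (hSL n).integrable_mul (hNL n)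
    have := integral_comp_prod_of_indepFun hI
      ((hSm.mono (ℱ.le n) le_rfl).prodMk ((hVP n).prodMk (hyP n))) (hζP n) hG hSi
    refine this.trans ?_
    simp only [integral_const_mul, hζμ, hg0, mul_zero, integral_zero]
  induction n with
  | zero => simp
  | succ n ih =>
    rw [Finset.sum_range_succ]
    have hexp : ∀ ω, (∑ k ∈ Finset.range (n + 1), N k ω) ^ 2
        = (∑ k ∈ Finset.range n, N k ω) ^ 2
          + 2 * ((∑ k ∈ Finset.range n, N k ω) * N n ω) + N n ω ^ 2 := fun ω => by
      rw [Finset.sum_range_succ]; ring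
    have h1 : Integrable (fun ω => (∑ k ∈ Finset.range n, N k ω) ^ 2) P := (hSL n).integrable_sq
    have h2 : Integrable (fun ω => 2 * ((∑ k ∈ Finset.range n, N k ω) * N n ω)) P :=
      ((hSL n).integrable_mul (hNL n)).const_mul 2
    have h12 : Integrable (fun ω => (∑ k ∈ Finset.range n, N k ω) ^ 2
          + 2 * ((∑ k ∈ Finset.range n, N k ω) * N n ω)) P := h1.add h2
    rw [integral_congr_ae (ae_of_all _ hexp), integral_add h12 (hNi n), integral_add h1 h2,
      integral_const_mul, hcross, mul_zero, add_zero]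
    exact add_le_add ih (hsq n)

end Parts

section Limit

variable {Ω : Type*} [MeasurableSpace Ω] {P : Measure Ω} [IsProbabilityMeasure P]

/-- Slutsky's theorem in the form used below: a Gaussian limit in terms of characteristic functions
is shifted by the `L¹` limit `m` of the rest. -/
lemma tendstoInDistribution_gaussianReal_of_charFun {S X : ℕ → Ω → ℝ} {m v : ℝ} (hv : 0 ≤ v)
    (hS : ∀ n, Measurable (S n))
    (hchar : ∀ θ : ℝ, Tendsto (fun n => ∫ ω, Complex.exp (((θ * S n ω : ℝ) : ℂ) * Complex.I) ∂P)
      atTop (nhds (Real.exp (-(θ ^ 2 * v / 2)) : ℂ)))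
    (hXi : ∀ n, Integrable (fun ω => X n ω - S n ω) P)
    (hrest : Tendsto (fun n => ∫ ω, |X n ω - S n ω - m| ∂P) atTop (nhds 0)) :
    TendstoInDistribution X atTop (id : ℝ → ℝ) (fun _ => P) (gaussianReal m v.toNNReal) := by
  have hclt : TendstoInDistribution S atTop (fun x : ℝ => x - m) (fun _ => P)
      (gaussianReal m v.toNNReal) :=
    { forall_aemeasurable := fun n => (hS n).aemeasurable
      tendsto := by
        refine ProbabilityMeasure.tendsto_iff_tendsto_charFun.2 fun θ => ?_
        simp only [ProbabilityMeasure.coe_mk]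
        rw [gaussianReal_map_sub_const, charFun_gaussianReal]
        have hlim : (Real.exp (-(θ ^ 2 * v / 2)) : ℂ) = Complex.exp ((θ : ℂ) * ((m - m : ℝ) : ℂ)
            * Complex.I - ((v.toNNReal : NNReal) : ℂ) * (θ : ℂ) ^ 2 / 2) := by
          have : ((v.toNNReal : NNReal) : ℂ) = (v : ℂ) :=
            congrArg Complex.ofReal (Real.coe_toNNReal v hv)
          rw [this]
          push_cast
          congr 1
          ring
        rw [← hlim]
        refine (hchar θ).congr fun n => ?_
        rw [charFun_apply_real, integral_map (hS n).aemeasurable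
          (Measurable.aestronglyMeasurable (by fun_prop))]
        simp }
  have hmeas : TendstoInMeasure P (fun n ω => X n ω - S n ω) atTop (fun _ => m) := by
    refine tendstoInMeasure_of_tendsto_eLpNorm one_ne_zero (fun n => (hXi n).1)
      aestronglyMeasurable_const ?_
    have h := ENNReal.tendsto_ofReal hrest
    rw [ENNReal.ofReal_zero] at h
    refine h.congr fun n => ?_
    rw [eLpNorm_one_eq_lintegral_enorm,
      ← ofReal_integral_norm_eq_lintegral_enorm ((hXi n).sub (integrable_const m))]
    rfl
  have := hclt.add_of_tendstoInMeasure_const hmeas fun n => (hXi n).1.aemeasurable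
  refine this.congr (fun n => ae_of_all _ fun ω => ?_) (ae_of_all _ fun x => ?_)
  · simp
  · simp

end Limit

section Rest

variable {Ω : Type*} [MeasurableSpace Ω] {P : Measure Ω} [IsProbabilityMeasure P]
  {ℱ : Filtration ℕ ‹MeasurableSpace Ω›} {ζ : ℕ → Ω → ℝ} {μ : Measure ℝ} [IsProbabilityMeasure μ]

/-- Apart from its part that is linear in `Y`, the sum converges in `L¹` to `d * 𝔼[V 0 * Y 0 ^ 2]`:
the martingale part of the remainder is `o(1)` in `L²`, and its compensator
`∑ V k * absShift μ (Y k / √n)` is an average of `d * V k * Y k ^ 2` up to `o(1)` in `L¹`. -/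
lemma tendsto_integral_abs_sum_sub_sub
    (hζm : ∀ k, Measurable[ℱ (k + 1)] (ζ k))
    (hζi : ∀ k, Indep (ℱ k) (MeasurableSpace.comap (ζ k) inferInstance) P)
    (hζμ : ∀ k, P.map (ζ k) = μ)
    {V Y : ℕ → Ω → ℝ} (hV : ∀ k, Measurable[ℱ k] (V k)) (hY : ∀ k, Measurable[ℱ k] (Y k))
    (hid : ∀ k, IdentDistrib (fun ω => (Y k ω, V k ω)) (fun ω => (Y 0 ω, V 0 ω)) P P)
    (hmom : Integrable (fun ω => Y 0 ω ^ 2 * V 0 ω ^ 2) P)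
    (hmean : Integrable (fun ω => V 0 ω * Y 0 ω ^ 2) P)
    (hlln : Tendsto (fun n : ℕ => ∫ ω, |(∑ k ∈ Finset.range n, V k ω * Y k ω ^ 2) / n
      - ∫ ω, V 0 ω * Y 0 ω ^ 2 ∂P| ∂P) atTop (nhds 0))
    {d : ℝ} (hmed : cdf μ 0 = 1 / 2)
    (hlo : (fun y => absShift μ y - d * y ^ 2) =o[nhds 0] fun y => y ^ 2) :
    (∀ n : ℕ, Integrable (fun ω =>
      ∑ k ∈ Finset.range n, V k ω * (|ζ k ω - (√(n : ℝ))⁻¹ * Y k ω| - |ζ k ω|)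
      - (√(n : ℝ))⁻¹ * ∑ k ∈ Finset.range n, V k ω * Y k ω * leSign (ζ k ω)) P) ∧
    Tendsto (fun n : ℕ => ∫ ω,
      |∑ k ∈ Finset.range n, V k ω * (|ζ k ω - (√(n : ℝ))⁻¹ * Y k ω| - |ζ k ω|)
      - (√(n : ℝ))⁻¹ * ∑ k ∈ Finset.range n, V k ω * Y k ω * leSign (ζ k ω)
      - d * ∫ ω, V 0 ω * Y 0 ω ^ 2 ∂P| ∂P) atTop (nhds 0) := by
  obtain ⟨C, hC0, hC⟩ := exists_abs_absShift_le_mul_sq μ hlo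
  have hVP : ∀ k, Measurable (V k) := fun k => (hV k).mono (ℱ.le k) le_rfl
  have hYP : ∀ k, Measurable (Y k) := fun k => (hY k).mono (ℱ.le k) le_rfl
  have hG := measurable_absShift μ
  set e : ℝ := ∫ ω, V 0 ω * Y 0 ω ^ 2 ∂P with he
  set r : ℝ → ℝ := fun y => absShift μ y - d * y ^ 2 with hr
  set q : ℝ → ℝ := fun y => 2 * |y| * absShift μ y with hq
  have hrm : Measurable r := by fun_prop
  have hqm : Measurable q := by fun_prop
  have hrC : ∀ y, |r y| ≤ (C + |d|) * y ^ 2 := fun y => by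
    have h1 := abs_sub (absShift μ y) (d * y ^ 2)
    rw [abs_mul, abs_of_nonneg (sq_nonneg y)] at h1
    simp only [hr]
    linarith [hC y]
  have hqC : ∀ y, |q y| ≤ 2 * y ^ 2 := fun y => by
    simp only [hq]
    rw [abs_mul, abs_mul, abs_two, abs_abs, ← sq_abs y]
    nlinarith [abs_absShift_le μ y, abs_nonneg y]
  have hqo : q =o[nhds 0] fun y => y ^ 2 := by
    have h1 : (fun y : ℝ => 2 * |y|) =o[nhds 0] fun _ => (1 : ℝ) := by
      rw [Asymptotics.isLittleO_one_iff]
      have : Continuous fun y : ℝ => 2 * |y| := by fun_prop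
      simpa using this.tendsto 0
    have h2 : absShift μ =O[nhds 0] fun y => y ^ 2 :=
      Asymptotics.IsBigO.of_bound C (Eventually.of_forall fun y => by
        rw [Real.norm_eq_abs, Real.norm_of_nonneg (sq_nonneg y)]; exact hC y)
    simpa [hq] using h1.mul_isBigO h2
  have hmom' : Integrable (fun ω => V 0 ω ^ 2 * Y 0 ω ^ 2) P := by
    simpa only [mul_comm] using hmom
  have hmean' : Integrable (fun ω => |V 0 ω| * Y 0 ω ^ 2) P := by
    simpa [abs_mul] using hmean.abs
  -- transfer along the identical distribution of the pairs `(Y k, V k)`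
  have hmomk : ∀ k, Integrable (fun ω => V k ω ^ 2 * Y k ω ^ 2) P := fun k =>
    ((hid k).comp (u := fun p : ℝ × ℝ => p.2 ^ 2 * p.1 ^ 2) (by fun_prop)).integrable_iff.2 hmom'
  have hmeank : ∀ k, Integrable (fun ω => V k ω * Y k ω ^ 2) P := fun k =>
    ((hid k).comp (u := fun p : ℝ × ℝ => p.2 * p.1 ^ 2) (by fun_prop)).integrable_iff.2 hmean
  have hri : ∀ (n k : ℕ), Integrable (fun ω => V k ω * r ((√(n : ℝ))⁻¹ * Y k ω)) P := by
    intro n k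
    have := hVP k
    have := hYP k
    refine Integrable.mono' ((hmeank k).abs.const_mul ((C + |d|) * (√(n : ℝ))⁻¹ ^ 2))
      (Measurable.aestronglyMeasurable (by fun_prop)) (ae_of_all _ fun ω => ?_)
    rw [Real.norm_eq_abs, abs_mul, abs_mul, abs_of_nonneg (sq_nonneg (Y k ω))]
    calc _ ≤ |V k ω| * ((C + |d|) * ((√(n : ℝ))⁻¹ * Y k ω) ^ 2) := by
          gcongr
          exact hrC _
      _ = _ := by ring
  have hqi : ∀ (n k : ℕ), Integrable (fun ω => V k ω ^ 2 * q ((√(n : ℝ))⁻¹ * Y k ω)) P := by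
    intro n k
    have := hVP k
    have := hYP k
    refine Integrable.mono' ((hmomk k).const_mul (2 * (√(n : ℝ))⁻¹ ^ 2))
      (Measurable.aestronglyMeasurable (by fun_prop)) (ae_of_all _ fun ω => ?_)
    rw [Real.norm_eq_abs, abs_mul, abs_of_nonneg (sq_nonneg (V k ω))]
    calc _ ≤ V k ω ^ 2 * (2 * ((√(n : ℝ))⁻¹ * Y k ω) ^ 2) := by
          gcongr
          exact hqC _
      _ = _ := by ring
  have hrk : ∀ (n k : ℕ), ∫ ω, |V k ω * r ((√(n : ℝ))⁻¹ * Y k ω)| ∂P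
      = ∫ ω, |V 0 ω| * |r ((√(n : ℝ))⁻¹ * Y 0 ω)| ∂P := fun n k => by
    have := ((hid k).comp (u := fun p : ℝ × ℝ => |p.2 * r ((√(n : ℝ))⁻¹ * p.1)|)
      (by fun_prop)).integral_eq
    simp only [Function.comp_def] at this
    rw [this]
    simp only [abs_mul]
  have hqk : ∀ (n k : ℕ), ∫ ω, V k ω ^ 2 * q ((√(n : ℝ))⁻¹ * Y k ω) ∂P
      = ∫ ω, V 0 ω ^ 2 * q ((√(n : ℝ))⁻¹ * Y 0 ω) ∂P := fun n k =>
    ((hid k).comp (u := fun p : ℝ × ℝ => p.2 ^ 2 * q ((√(n : ℝ))⁻¹ * p.1))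
      (by fun_prop)).integral_eq
  have hN := fun n : ℕ => integral_sq_sum_mul_le hζm hζi hζμ hV
    (y := fun k ω => (√(n : ℝ))⁻¹ * Y k ω) (fun k => (hY k).const_mul _)
    (fun k => by
      simpa only [mul_pow, mul_left_comm] using (hmomk k).const_mul ((√(n : ℝ))⁻¹ ^ 2))
    (measurable_absRemainder μ) (abs_absRemainder_le μ) (integral_absRemainder hmed)
    (integral_absRemainder_sq_le hmed) (hqi n) n
  have hdec : ∀ (n : ℕ) ω,
      ∑ k ∈ Finset.range n, V k ω * (|ζ k ω - (√(n : ℝ))⁻¹ * Y k ω| - |ζ k ω|)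
      - (√(n : ℝ))⁻¹ * ∑ k ∈ Finset.range n, V k ω * Y k ω * leSign (ζ k ω)
      = ∑ k ∈ Finset.range n, V k ω * absRemainder μ ((√(n : ℝ))⁻¹ * Y k ω) (ζ k ω)
        + ∑ k ∈ Finset.range n, V k ω * r ((√(n : ℝ))⁻¹ * Y k ω)
        + d * ((∑ k ∈ Finset.range n, V k ω * Y k ω ^ 2) / n) := by
    intro n ω
    have hsn : (n : ℝ)⁻¹ = (√(n : ℝ))⁻¹ ^ 2 := by rw [inv_pow, Real.sq_sqrt n.cast_nonneg]
    rw [div_eq_mul_inv, hsn, Finset.mul_sum, Finset.sum_mul, Finset.mul_sum,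
      ← Finset.sum_sub_distrib, ← Finset.sum_add_distrib, ← Finset.sum_add_distrib]
    refine Finset.sum_congr rfl fun k _ => ?_
    simp only [hr, absRemainder]
    ring
  have hi1 := fun n => ((hN n).1.integrable one_le_two)
  have hi2 : ∀ n : ℕ, Integrable
      (fun ω => ∑ k ∈ Finset.range n, V k ω * r ((√(n : ℝ))⁻¹ * Y k ω)) P := fun n =>
    integrable_finsetSum _ fun k _ => hri n k
  have hi3 : ∀ n : ℕ, Integrable (fun ω => (∑ k ∈ Finset.range n, V k ω * Y k ω ^ 2) / (n : ℝ)) P :=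
    fun n => (integrable_finsetSum _ fun k _ => hmeank k).div_const _
  simp only [hdec]
  refine ⟨fun n => ((hi1 n).add (hi2 n)).add ((hi3 n).const_mul d), ?_⟩
  have hT1 := tendsto_natCast_mul_integral_mul_comp ((hVP 0).pow_const 2) (hYP 0) hmom' hqm hqC hqo
  have hT2 := tendsto_natCast_mul_integral_mul_comp (hVP 0).abs (hYP 0) hmean' (r := fun y => |r y|)
    hrm.abs (fun y => by rw [abs_abs]; exact hrC y) hlo.norm_left
  have hbound := (hT1.sqrt.add hT2).add (hlln.const_mul |d|)
  rw [Real.sqrt_zero, mul_zero, add_zero, add_zero] at hbound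
  refine squeeze_zero (fun n => integral_nonneg fun ω => abs_nonneg _) (fun n => ?_) hbound
  have hb1 : ∫ ω, |∑ k ∈ Finset.range n,
      V k ω * absRemainder μ ((√(n : ℝ))⁻¹ * Y k ω) (ζ k ω)| ∂P
      ≤ √(n * ∫ ω, V 0 ω ^ 2 * q ((√(n : ℝ))⁻¹ * Y 0 ω) ∂P) := by
    refine (integral_abs_le_sqrt_integral_sq (hN n).1).trans (Real.sqrt_le_sqrt ?_)
    refine (hN n).2.trans_eq ?_
    rw [Finset.sum_congr rfl fun k _ => hqk n k]
    simp
  have hb2 : ∫ ω, ∑ k ∈ Finset.range n, |V k ω * r ((√(n : ℝ))⁻¹ * Y k ω)| ∂P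
      = n * ∫ ω, |V 0 ω| * |r ((√(n : ℝ))⁻¹ * Y 0 ω)| ∂P := by
    rw [integral_finsetSum _ fun k _ => (hri n k).abs, Finset.sum_congr rfl fun k _ => hrk n k]
    simp
  have hj2 : Integrable
      (fun ω => ∑ k ∈ Finset.range n, |V k ω * r ((√(n : ℝ))⁻¹ * Y k ω)|) P :=
    integrable_finsetSum _ fun k _ => (hri n k).abs
  have hj3 : Integrable
      (fun ω => |(∑ k ∈ Finset.range n, V k ω * Y k ω ^ 2) / (n : ℝ) - e|) P :=
    ((hi3 n).sub (integrable_const e)).abs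
  have hj12 : Integrable (fun ω => |∑ k ∈ Finset.range n,
      V k ω * absRemainder μ ((√(n : ℝ))⁻¹ * Y k ω) (ζ k ω)|
      + ∑ k ∈ Finset.range n, |V k ω * r ((√(n : ℝ))⁻¹ * Y k ω)|) P := (hi1 n).abs.add hj2
  calc _ ≤ ∫ ω, (|∑ k ∈ Finset.range n,
      V k ω * absRemainder μ ((√(n : ℝ))⁻¹ * Y k ω) (ζ k ω)|
      + ∑ k ∈ Finset.range n, |V k ω * r ((√(n : ℝ))⁻¹ * Y k ω)|
      + |d| * |(∑ k ∈ Finset.range n, V k ω * Y k ω ^ 2) / (n : ℝ) - e|) ∂P := by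
        refine integral_mono_of_nonneg (ae_of_all _ fun ω => abs_nonneg _)
          (hj12.add (hj3.const_mul _)) (ae_of_all _ fun ω => ?_)
        simp only
        rw [add_sub_assoc, ← mul_sub, ← abs_mul]
        refine (abs_add_le _ _).trans (add_le_add ((abs_add_le _ _).trans ?_) le_rfl)
        gcongr
        exact Finset.abs_sum_le_sum_abs _ _
    _ ≤ _ := by
        rw [integral_add hj12 (hj3.const_mul _), integral_add (hi1 n).abs hj2, integral_const_mul,
          hb2]
        gcongr

end Rest

/-! ### The limit law -/

lemma sum_Icc_one_eq_sum_range (n : ℕ) (g : ℤ → ℝ) :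
    ∑ t ∈ Finset.Icc (1 : ℤ) n, g t = ∑ k ∈ Finset.range n, g (k + 1) := by
  refine (Finset.sum_nbij (fun k : ℕ => (k : ℤ) + 1) ?_ ?_ ?_ fun _ _ => rfl).symm
  · intro k hk
    simp only [Finset.mem_range, Finset.mem_Icc] at hk ⊢
    omega
  · intro a _ b _ h
    simpa using h
  · intro t ht
    simp only [Finset.coe_Icc, mem_Icc] at ht
    exact ⟨(t - 1).toNat, by simp; omega, by simp; omega⟩

theorem theorem2 {Ω : Type*} [MeasurableSpace Ω] (P : Measure Ω) [IsProbabilityMeasure P]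
    (Z Y V : ℤ → Ω → ℝ)
    -- `(Z_t)` is i.i.d. with finite variance
    (hZ : ∀ t, Measurable (Z t))
    (hindep : iIndepFun Z P)
    (hident : ∀ t, IdentDistrib (Z t) (Z 0) P P)
    (hvar : MemLp (Z 0) 2 P)
    -- the common distribution function is symmetric
    (hsymm : ∀ x : ℝ, cdf (P.map (Z 0)) (-x) = 1 - cdf (P.map (Z 0)) x)
    -- and continuously differentiable in a neighbourhood of `0`, with derivative `f`
    (f : ℝ → ℝ) (ε : ℝ) (hε : 0 < ε)
    (hderiv : ∀ x ∈ Ioo (-ε) ε, HasDerivAt (cdf (P.map (Z 0))) (f x) x)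
    (hcont : ContinuousOn f (Ioo (-ε) ε))
    -- `(Y_t)` and `(V_t)` are adapted to `ℱ_t = σ(Z_t, Z_{t-1}, …)` and (jointly) stationary
    (hY : Adapted (Filtration.natural Z fun t => (hZ t).stronglyMeasurable) Y)
    (hV : Adapted (Filtration.natural Z fun t => (hZ t).stronglyMeasurable) V)
    (hstat : IsStationaryProcess P fun t ω => (Y t ω, V t ω))
    -- moments
    (hmom : Integrable (fun ω => Y 0 ω ^ 2 * V 0 ω ^ 2) P)
    (hmean : Integrable (fun ω => V 0 ω * Y 0 ω ^ 2) P) :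
    TendstoInDistribution
      (fun (n : ℕ) ω => ∑ t ∈ Finset.Icc (1 : ℤ) n,
        V (t - 1) ω * (|Z t ω - (n : ℝ) ^ (-(1 / 2) : ℝ) * Y (t - 1) ω| - |Z t ω|))
      atTop (id : ℝ → ℝ) (fun _ => P)
      (gaussianReal (f 0 * ∫ ω, V 0 ω * Y 0 ω ^ 2 ∂P)
        (∫ ω, V 0 ω ^ 2 * Y 0 ω ^ 2 ∂P).toNNReal) := by
  have hVm : ∀ t, Measurable (V t) := fun t => (hV t).mono (Filtration.le _ _) le_rfl
  have hYm : ∀ t, Measurable (Y t) := fun t => (hY t).mono (Filtration.le _ _) le_rfl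
  set μ : Measure ℝ := P.map (Z 0) with hμ
  have : IsProbabilityMeasure μ := Measure.isProbabilityMeasure_map (hZ 0).aemeasurable
  have hmed : cdf μ 0 = 1 / 2 := by
    have := hsymm 0
    rw [neg_zero] at this
    linarith
  have hlo := absShift_sub_isLittleO μ hε (fun x hx => (hderiv x hx).continuousAt)
    (hderiv 0 ⟨by linarith, hε⟩) hmed
  -- the filtration at the times `0, 1, 2, …`
  let ℱ : Filtration ℕ ‹MeasurableSpace Ω› :=
    { seq := fun k => (Filtration.natural Z fun t => (hZ t).stronglyMeasurable) k
      mono' := fun i j hij => Filtration.mono _ (by exact_mod_cast hij)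
      le' := fun k => Filtration.le _ _ }
  have hζm : ∀ k : ℕ, Measurable[ℱ (k + 1)] (Z (k + 1)) := fun k => by
    refine measurable_iff_comap_le.2 ?_
    exact le_iSup₂_of_le (f := fun j _ => MeasurableSpace.comap (Z j) inferInstance)
      ((k : ℤ) + 1) (by push_cast; exact le_rfl) le_rfl
  have hζi : ∀ k : ℕ, Indep (ℱ k) (MeasurableSpace.comap (Z (k + 1)) inferInstance) P := by
    intro k
    have := indep_iSup_of_disjoint (fun j => (hZ j).comap_le) hindep.iIndep
      (S := Iic (k : ℤ)) (T := {(k : ℤ) + 1}) (by simp)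
    rw [iSup_singleton] at this
    exact this
  have hζμ : ∀ k : ℕ, P.map (Z (k + 1)) = μ := fun k => (hident _).map_eq
  have hξi : ∀ k : ℕ,
      Indep (ℱ k) (MeasurableSpace.comap (fun ω => leSign (Z (k + 1) ω)) inferInstance) P :=
    fun k => indep_of_indep_of_le_right (hζi k)
      (measurable_leSign.comp (comap_measurable (Z (k + 1)))).comap_le
  have hξ0 : ∀ k : ℕ, ∫ ω, leSign (Z (k + 1) ω) ∂P = 0 := fun k => by
    rw [← integral_map (hZ _).aemeasurable measurable_leSign.aestronglyMeasurable, hζμ,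
      integral_leSign hmed]
  -- the two laws of large numbers
  have hllnV := tendsto_integral_abs_average_sub hZ hindep
    (X := fun t ω => V t ω * Y t ω ^ 2) (fun t => (hV t).mul ((hY t).pow_const 2))
    (hstat.comp (g := fun p : ℝ × ℝ => p.2 * p.1 ^ 2) (by fun_prop)) hmean
  have hmom' : Integrable (fun ω => (V 0 ω * Y 0 ω) ^ 2) P := by
    simpa only [mul_pow, mul_comm] using hmom
  have hllnQ := tendsto_integral_abs_average_sub hZ hindep
    (X := fun t ω => (V t ω * Y t ω) ^ 2) (fun t => ((hV t).mul (hY t)).pow_const 2)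
    (hstat.comp (g := fun p : ℝ × ℝ => (p.2 * p.1) ^ 2) (by fun_prop)) hmom'
  have hv : 0 ≤ ∫ ω, (V 0 ω * Y 0 ω) ^ 2 ∂P := integral_nonneg fun ω => sq_nonneg _
  have hchar := tendsto_integral_cexp_sum_mul_sign (ℱ := ℱ)
    (fun k => measurable_leSign.comp (hζm k)) hξi (fun k ω => leSign_eq _) hξ0
    (A := fun k ω => V k ω * Y k ω) (fun k => (hV k).mul (hY k))
    (fun k => (hstat.identDistrib k).comp (u := fun p : ℝ × ℝ => p.2 * p.1) (by fun_prop))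
    hmom' hv hllnQ
  obtain ⟨hXi, hrest⟩ := tendsto_integral_abs_sum_sub_sub (ℱ := ℱ) hζm hζi hζμ
    (V := fun k => V k) (Y := fun k => Y k) (fun k => hV k) (fun k => hY k)
    (fun k => hstat.identDistrib k) hmom hmean hllnV hmed hlo
  have hfinal := tendstoInDistribution_gaussianReal_of_charFun hv
    (fun n => (Finset.measurable_fun_sum _ fun (k : ℕ) _ => ((hVm k).mul (hYm k)).mul
      (measurable_leSign.comp (hZ (k + 1)))).const_mul _)
    hchar hXi hrest
  simp only [mul_pow] at hfinal
  refine hfinal.congr (fun n => ae_of_all _ fun ω => ?_) (ae_of_all _ fun x => rfl)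
  have hpow : (n : ℝ) ^ (-(1 / 2) : ℝ) = (√(n : ℝ))⁻¹ := by
    rw [Real.rpow_neg n.cast_nonneg, Real.sqrt_eq_rpow]
  beta_reduce
  rw [sum_Icc_one_eq_sum_range]
  simp only [hpow, add_sub_cancel_right]
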